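/- Let $n\ge 2$, $t=n(n-1)/2$, $d=n+t=n(n+1)/2$. For $k\ge 0$ let $Sh_k$ be the $\mathbb{Q}$-vector space generated by symbols $[v_1,\dots,v_{n+k}]$ with $v_i\in\mathbb{Q}^n$ nonzero column vectors, modulo (i) $[v_{\sigma(1)},\dots,v_{\sigma(n+k)}]-\mathrm{sign}(\sigma)[v_1,\dots,v_{n+k}]$ for permutations $\sigma$; (ii) $[v_1,\dots,v_{n+k}]$ if the $v_i$ do not span $\mathbb{Q}^n$; (iii) $[v_1,\dots,v_{n+k}]-[av_1,v_2,\dots,v_{n+k}]$ for $a\in\mathbb{Q}^\times$. The classes of the symbols are called basic sharblies. Let $g[v_1,\dots]=[gv_1,\dots]$ for $g\in \mathrm{GL}_n(\mathbb{Q})$, and let $\partial\colon Sh_{k+1}\to Sh_k$ be given by $\partial[v_1,\dots,v_m]=\sum_i(-1)^{i+1}[v_1,\dots,\widehat{v_i},\dots,v_m]$. For a subgroup $G\subseteq \mathrm{SL}_n(\mathbb{Z})$, a ($G$-invariant, real-valued) $t$-cosharbly cocycle is a $\mathbb{Q}$-linear map $\mu\colon Sh_t\to\mathbb{R}$ with $\mu(gz)=\mu(z)$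 for all $g\in G$, $z\in Sh_t$, and $\mu(\partial[v_1,\dots,v_{d+1}])=0$ for all nonzero $v_1,\dots,v_{d+1}\in\mathbb{Q}^n$. Let $Y$ be the $d$-dimensional space of real symmetric $n\times n$ matrices, with a fixed orientation, $C\subset Y$ the open cone of positive definite matrices, with $g\in\mathrm{SL}_n(\mathbb{R})$ acting by $y\mapsto gy\,{}^tg$, and $A=\mathbb{R}_{>0}$ acting by homotheties. For a nonzero $v\in\mathbb{Q}^n$ put $v'=v\,{}^tv\in Y$; let $s(v_1,\dots,v_m)$ be the closed convex cone generated by $v_1',\dots,v_m'$. If $v_1',\dots,v_d'$ are linearly independent and the basis $(v_1',\dots,v_d')$ induces the chosen orientation of $Y$, then for the top-dimensional simplicial cone $s=s(v_1,\dots,v_d)$ we write $[s]=[v_1,\dots,v_d]$. A flipon is a basic $t$-sharbly $[w_1,\dots,w_d]$ such that $w_1',\dots,w_d'$ lie in a $(d-2)$-dimensional affine subspace of $Y$. Let $\nu$ be the measure on $C/A$ for which $\nu(E)$ is the Lebesgue measure, with respect to $\prod_{i\le j}dy_{ij}$, of $\{y\in C: Ay\in E,\ \det y\le 1\}$. Theorem.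 The measure $\nu$ is $\mathrm{SL}_n(\mathbb{R})$-invariant. For all nonzero $v_1,\dots,v_d\in\mathbb{Q}^n$ the volume $\mathrm{vol}(s(v_1,\dots,v_d)):=\nu\big((s(v_1,\dots,v_d)\cap C)/A\big)$ is finite. There is a $\mathbb{Q}$-linear map $\mu\colon Sh_t\to\mathbb{R}$ with \[\mu([v_1,\dots,v_d])=e\cdot\mathrm{vol}(s(v_1,\dots,v_d))\] for all nonzero $v_1,\dots,v_d\in\mathbb{Q}^n$, where $e=1$ if $(v_1',\dots,v_d')$ is a basis of $Y$ inducing the chosen orientation and $e=-1$ otherwise. This $\mu$ is a $t$-cosharbly cocycle for every subgroup $G$ of $\mathrm{SL}_n(\mathbb{Z})$, and $\mu(z)\ne 0$ for every $z\in Sh_t$ of the form \[z=\sum_{i=1}^p\lambda_i[s_i]+\sum_{j=1}^q\kappa_j[w^{(j)}_1,\dots,w^{(j)}_d],\] where $p\ge 1$, $q\ge 0$, $\lambda_i,\kappa_j\in\mathbb{Q}$, all $\lambda_i>0$, each $s_i$ is a top-dimensional simplicial cone as above, and each $[w^{(j)}_1,\dots,w^{(j)}_d]$ is a flipon. -/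

import Mathlib

open MeasureTheory
open scoped MatrixGroups

namespace Sharbly

/-! ### The sharbly complex -/

/-- Nonzero column vectors in `ℚⁿ`. -/
def NZVec (n : ℕ) : Type := {v : Fin n → ℚ // v ≠ 0}

/-- The nonzero vector `a v`, for `a ∈ ℚˣ`. -/
def NZVec.scale {n : ℕ} (a : ℚˣ) (v : NZVec n) : NZVec n :=
  ⟨(a : ℚ) • v.1, smul_ne_zero a.ne_zero v.2⟩

/-- The nonzero vector `g v`, for `g ∈ GLₙ(ℚ)`. -/
def NZVec.act {n : ℕ} (g : GL (Fin n) ℚ) (v : NZVec n) : NZVec n :=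
  ⟨(g : Matrix (Fin n) (Fin n) ℚ).mulVec v.1, fun h => v.2
    (Matrix.mulVec_injective_of_isUnit g.isUnit (by rw [h, Matrix.mulVec_zero]))⟩

/-- The `ℚ`-vector space freely generated by the symbols `[v₁, …, v_m]`. -/
abbrev FreeSymbols (n m : ℕ) : Type := (Fin m → NZVec n) →₀ ℚ

/-- The relators between symbols `[v₁, …, v_m]`. -/
inductive Relator (n m : ℕ) : FreeSymbols n m → Prop
  | perm (v : Fin m → NZVec n) (σ : Equiv.Perm (Fin m)) :
      Relator n m (Finsupp.single (v ∘ σ) 1 -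
        ((Equiv.Perm.sign σ : ℤ) : ℚ) • Finsupp.single v 1)
  | degenerate (v : Fin m → NZVec n)
      (hv : Submodule.span ℚ (Set.range fun i => (v i).1) ≠ ⊤) :
      Relator n m (Finsupp.single v 1)
  | scale (v : Fin m → NZVec n) (i : Fin m) (a : ℚˣ) :
      Relator n m (Finsupp.single v 1 -
        Finsupp.single (Function.update v i ((v i).scale a)) 1)

/-- The space `Sh_k` of `k`-sharblies for `GLₙ(ℚ)`. -/
abbrev Sh (n k : ℕ) : Type :=
  FreeSymbols n (n + k) ⧸ Submodule.span ℚ {x | Relator n (n + k) x}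

/-- The basic sharbly `[v₁, …, v_{n+k}]`. -/
noncomputable def basic {n k : ℕ} (v : Fin (n + k) → NZVec n) : Sh n k :=
  Submodule.Quotient.mk (Finsupp.single v 1)

theorem basic_perm {n k : ℕ} (v : Fin (n + k) → NZVec n) (σ : Equiv.Perm (Fin (n + k))) :
    basic (v ∘ σ) = ((Equiv.Perm.sign σ : ℤ) : ℚ) • basic v := by
  rw [basic, basic, ← Submodule.Quotient.mk_smul, Submodule.Quotient.eq]
  exact Submodule.subset_span (Relator.perm v σ)

theorem basic_degenerate {n k : ℕ} (v : Fin (n + k) → NZVec n)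
    (hv : Submodule.span ℚ (Set.range fun i => (v i).1) ≠ ⊤) : basic v = 0 := by
  rw [basic, Submodule.Quotient.mk_eq_zero]
  exact Submodule.subset_span (Relator.degenerate v hv)

theorem basic_scale {n k : ℕ} (v : Fin (n + k) → NZVec n) (i : Fin (n + k)) (a : ℚˣ) :
    basic (Function.update v i ((v i).scale a)) = basic v := by
  symm
  rw [basic, basic, Submodule.Quotient.eq]
  exact Submodule.subset_span (Relator.scale v i a)

/-- A function on symbols that respects the relators induces a linear map on sharblies. -/
noncomputable def liftSh {n k : ℕ} {E : Type*} [AddCommGroup E] [Module ℚ E]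
    (F : (Fin (n + k) → NZVec n) → E)
    (h1 : ∀ v (σ : Equiv.Perm (Fin (n + k))),
      F (v ∘ σ) = ((Equiv.Perm.sign σ : ℤ) : ℚ) • F v)
    (h2 : ∀ v, Submodule.span ℚ (Set.range fun i => (v i).1) ≠ ⊤ → F v = 0)
    (h3 : ∀ v i (a : ℚˣ), F (Function.update v i ((v i).scale a)) = F v) :
    Sh n k →ₗ[ℚ] E :=
  Submodule.liftQ _ (Finsupp.lift E ℚ _ F) (by
    rw [Submodule.span_le]
    rintro x (⟨v, σ⟩ | ⟨v, hv⟩ | ⟨v, i, a⟩)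
    · rw [SetLike.mem_coe, LinearMap.mem_ker, map_sub, map_smul]
      simp [h1]
    · simp [h2 v hv]
    · rw [SetLike.mem_coe, LinearMap.mem_ker, map_sub]
      simp [h3])

theorem liftSh_basic {n k : ℕ} {E : Type*} [AddCommGroup E] [Module ℚ E]
    (F : (Fin (n + k) → NZVec n) → E) (h1 h2 h3) (v : Fin (n + k) → NZVec n) :
    liftSh F h1 h2 h3 (basic v) = F v := by
  simp [liftSh, basic]

/-- The action of `g ∈ GLₙ(ℚ)` on `Sh_k`: `g [v₁, …] = [g v₁, …]`. -/
noncomputable def actSh {n k : ℕ} (g : GL (Fin n) ℚ) : Sh n k →ₗ[ℚ] Sh n k :=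
  liftSh (fun v => basic fun i => (v i).act g)
    (fun v σ => basic_perm (fun i => (v i).act g) σ)
    (fun v hv => basic_degenerate _ fun h => hv (by
      have e : (Set.range fun i => ((v i).act g).1) =
          (Matrix.toLin' (g : Matrix (Fin n) (Fin n) ℚ)) '' (Set.range fun i => (v i).1) := by
        rw [← Set.range_comp]; rfl
      rw [e, Submodule.span_image] at h
      have inj : Function.Injective (Matrix.toLin' (g : Matrix (Fin n) (Fin n) ℚ)) :=
        Matrix.mulVec_injective_of_isUnit g.isUnit
      apply Submodule.map_injective_of_injective inj
      rw [h, Submodule.map_top, LinearMap.range_eq_top.2 (LinearMap.injective_iff_surjective.1 inj)]))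
    (fun v i a => by
      rw [← basic_scale (fun i => (v i).act g) i a]
      congr 1
      funext j
      by_cases hj : j = i
      · subst hj
        rw [Function.update_self, Function.update_self]
        exact Subtype.ext (Matrix.mulVec_smul (g : Matrix (Fin n) (Fin n) ℚ) (a : ℚ) (v j).1)
      · simp [hj])

/-- `∂[v₁, …, v_{m}] = ∑ᵢ (-1)^(i+1) [v₁, …, v̂ᵢ, …, v_m]` (indices from `0` in the code). -/
noncomputable def boundaryBasic {n k : ℕ} (v : Fin (n + (k + 1)) → NZVec n) : Sh n k :=
  ∑ i : Fin (n + k + 1), (-1 : ℚ) ^ (i : ℕ) • basic fun j : Fin (n + k) => v (i.succAbove j)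

theorem swap_succAbove_of_ne {m : ℕ} (a : Fin m) (i : Fin (m + 1))
    (h1 : i ≠ a.castSucc) (h2 : i ≠ a.succ) :
    ∃ b c : Fin m, b ≠ c ∧ ∀ j, Equiv.swap a.castSucc a.succ (i.succAbove j) =
      i.succAbove (Equiv.swap b c j) := by
  obtain ⟨b, hb⟩ := Fin.exists_succAbove_eq h1.symm
  obtain ⟨c, hc⟩ := Fin.exists_succAbove_eq h2.symm
  refine ⟨b, c, ?_, fun j => ?_⟩
  · rintro rfl
    exact Fin.castSucc_lt_succ.ne (hb.symm.trans hc)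
  · rw [← hb, ← hc]
    exact (Function.Injective.map_swap Fin.succAbove_right_injective _ _ _).symm

theorem swap_castSucc_succAbove {m : ℕ} (a j : Fin m) :
    Equiv.swap a.castSucc a.succ (a.castSucc.succAbove j) = a.succ.succAbove j := by
  ext
  simp only [Fin.succAbove, Equiv.swap_apply_def]
  split_ifs <;> simp only [Fin.ext_iff, Fin.lt_def, Fin.val_castSucc, Fin.val_succ] at * <;> omega

theorem boundaryBasic_swap {n k : ℕ} (v : Fin (n + (k + 1)) → NZVec n) (a : Fin (n + k)) :
    boundaryBasic (v ∘ Equiv.swap (a.castSucc : Fin (n + k + 1)) a.succ) =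
      - boundaryBasic v := by
  unfold boundaryBasic
  rw [← Finset.sum_neg_distrib,
    ← Equiv.sum_comp (Equiv.swap (a.castSucc : Fin (n + k + 1)) a.succ)
      (fun i => -((-1 : ℚ) ^ (i : ℕ) • basic fun j : Fin (n + k) => v (i.succAbove j)))]
  refine Finset.sum_congr rfl fun i _ => ?_
  by_cases h1 : i = a.castSucc
  · subst h1
    simp only [Function.comp_apply, swap_castSucc_succAbove]
    simp [pow_succ]
  by_cases h2 : i = a.succ
  · subst h2
    have : ∀ j, Equiv.swap a.castSucc a.succ (a.succ.succAbove j) = a.castSucc.succAbove j := by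
      intro j
      rw [← swap_castSucc_succAbove, Equiv.swap_apply_self]
    simp only [Function.comp_apply, this]
    simp [pow_succ]
  · rw [Equiv.swap_apply_of_ne_of_ne h1 h2]
    obtain ⟨b, c, hbc, h⟩ := swap_succAbove_of_ne a i h1 h2
    have e := basic_perm (fun j : Fin (n + k) => v (i.succAbove j)) (Equiv.swap b c)
    rw [Equiv.Perm.sign_swap hbc] at e
    have e' : (fun j : Fin (n + k) =>
        (v ∘ Equiv.swap (a.castSucc : Fin (n + k + 1)) a.succ) (i.succAbove j)) =
        (fun j : Fin (n + k) => v (i.succAbove j)) ∘ Equiv.swap b c := by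
      funext j
      exact congrArg v (h j)
    rw [e', e]
    simp

theorem boundaryBasic_perm {n k : ℕ} (v : Fin (n + (k + 1)) → NZVec n)
    (σ : Equiv.Perm (Fin (n + (k + 1)))) :
    boundaryBasic (v ∘ σ) = ((Equiv.Perm.sign σ : ℤ) : ℚ) • boundaryBasic v := by
  have key : ∀ σ ∈ (⊤ : Submonoid (Equiv.Perm (Fin (n + k + 1)))),
      ∀ v : Fin (n + (k + 1)) → NZVec n,
      boundaryBasic (v ∘ σ) = ((Equiv.Perm.sign σ : ℤ) : ℚ) • boundaryBasic v := by
    intro σ hσ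
    rw [← Equiv.Perm.mclosure_swap_castSucc_succ] at hσ
    induction hσ using Submonoid.closure_induction with
    | mem x hx =>
      obtain ⟨a, rfl⟩ := hx
      intro v
      rw [boundaryBasic_swap, Equiv.Perm.sign_swap (Fin.castSucc_lt_succ.ne)]
      simp
    | one => intro v; simp
    | mul x y _ _ hx hy =>
      intro v
      rw [Equiv.Perm.coe_mul, ← Function.comp_assoc, hy, hx, smul_smul, Equiv.Perm.sign_mul]
      congr 1
      push_cast
      ring
  exact key σ trivial v

/-- The boundary map `∂ : Sh_{k+1} → Sh_k`. -/
noncomputable def boundary {n k : ℕ} : Sh n (k + 1) →ₗ[ℚ] Sh n k :=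
  liftSh boundaryBasic boundaryBasic_perm
    (fun v hv => Finset.sum_eq_zero fun i _ => by
      rw [basic_degenerate, smul_zero]
      intro h
      apply hv
      rw [eq_top_iff, ← h]
      apply Submodule.span_mono
      rintro _ ⟨j, rfl⟩
      exact ⟨_, rfl⟩)
    (fun v i a => by
      refine Finset.sum_congr rfl fun l _ => ?_
      congr 1
      by_cases hl : l = i
      · subst hl
        congr 1
        funext j
        rw [Function.update_of_ne (Fin.succAbove_ne l j)]
      · obtain ⟨j, hj⟩ := Fin.exists_succAbove_eq (Ne.symm hl)
        rw [← basic_scale (fun j : Fin (n + k) => v (l.succAbove j)) j a, ← hj]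
        congr 1
        exact Function.update_comp_eq_of_injective v Fin.succAbove_right_injective j _)

/-- A `k`-cosharbly for `G ⊆ SLₙ(ℤ)` with values in the trivial module `E` is a linear functional
on `Sh_k` with `IsCosharbly G μ`. -/
def IsCosharbly {n k : ℕ} {E : Type*} [AddCommGroup E] [Module ℚ E]
    (G : Subgroup SL(n, ℤ)) (μ : Sh n k →ₗ[ℚ] E) : Prop :=
  ∀ g ∈ G, ∀ z : Sh n k,
    μ (actSh (Matrix.SpecialLinearGroup.toGL
      (Matrix.SpecialLinearGroup.map (Int.castRingHom ℚ) g)) z) = μ z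

/-- The cocycle condition for a cosharbly. -/
def IsCosharblyCocycle {n k : ℕ} {E : Type*} [AddCommGroup E] [Module ℚ E]
    (G : Subgroup SL(n, ℤ)) (μ : Sh n k →ₗ[ℚ] E) : Prop :=
  IsCosharbly G μ ∧
    ∀ v : Fin (n + (k + 1)) → NZVec n, μ (boundary (basic v)) = 0

/-! ### The cone of positive definite matrices and its quotient by homotheties -/

/-- The space `Y` of real symmetric `n × n` matrices. -/
def SymMat (n : ℕ) : Submodule ℝ (Matrix (Fin n) (Fin n) ℝ) where
  carrier := {y | y.IsSymm}
  add_mem' h1 h2 := h1.add h2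
  zero_mem' := Matrix.isSymm_zero
  smul_mem' a _ h := h.smul a

/-- `Y` carries its Borel `σ`-algebra. -/
instance (n : ℕ) : MeasurableSpace (SymMat n) := borel _

instance (n : ℕ) : BorelSpace (SymMat n) := ⟨rfl⟩

/-- The symmetric matrix with given entries `y_{ij}`, `i ≤ j`. -/
def symOfUpper {n : ℕ} (x : {p : Fin n × Fin n // p.1 ≤ p.2} → ℝ) : SymMat n :=
  ⟨Matrix.of fun i j => x ⟨(min i j, max i j), min_le_max⟩, by
    ext i j
    simp [min_comm, max_comm]⟩

/-- Lebesgue measure `∏_{i ≤ j} dy_{ij}` on `Y`. -/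
noncomputable def lebesgueSym (n : ℕ) : Measure (SymMat n) :=
  Measure.map symOfUpper volume

/-- The action `y ↦ g y ᵗg` of `SLₙ(ℝ)` on `Y`. -/
def actSym {n : ℕ} (g : SL(n, ℝ)) (y : SymMat n) : SymMat n :=
  ⟨(g : Matrix (Fin n) (Fin n) ℝ) * y.1 * (g : Matrix (Fin n) (Fin n) ℝ).transpose, by
    have hy : y.1.transpose = y.1 := y.2
    change Matrix.transpose _ = _
    simp [Matrix.transpose_mul, hy, Matrix.mul_assoc]⟩

/-- The open cone `C ⊆ Y` of positive definite matrices. -/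
def PosCone (n : ℕ) : Type := {y : SymMat n // (y : Matrix (Fin n) (Fin n) ℝ).PosDef}

instance (n : ℕ) : MeasurableSpace (PosCone n) := Subtype.instMeasurableSpace

/-- Two points of `C` are equivalent if they differ by a homothety in `A = ℝ_{>0}`. -/
def homothety (n : ℕ) : Setoid (PosCone n) where
  r y z := ∃ a : ℝ, 0 < a ∧ z.1 = a • y.1
  iseqv :=
    { refl := fun y => ⟨1, one_pos, (one_smul ℝ y.1).symm⟩
      symm := by
        rintro y z ⟨a, ha, h⟩
        exact ⟨a⁻¹, inv_pos.2 ha, by rw [h, smul_smul, inv_mul_cancel₀ ha.ne', one_smul]⟩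
      trans := by
        rintro x y z ⟨a, ha, h⟩ ⟨b, hb, h'⟩
        exact ⟨b * a, mul_pos hb ha, by rw [h', h, smul_smul]⟩ }

/-- The symmetric space `C/A`. -/
abbrev SymSpace (n : ℕ) : Type := Quotient (homothety n)

/-- The action of `SLₙ(ℝ)` on `C`. -/
def actPosCone {n : ℕ} (g : SL(n, ℝ)) (y : PosCone n) : PosCone n :=
  ⟨actSym g y.1, by
    have hg : IsUnit (g : Matrix (Fin n) (Fin n) ℝ) := by
      rw [Matrix.isUnit_iff_isUnit_det, g.det_coe]; exact isUnit_one
    have := y.2.mul_mul_conjTranspose_same (B := (g : Matrix (Fin n) (Fin n) ℝ))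
      (Matrix.vecMul_injective_of_isUnit hg)
    rwa [Matrix.conjTranspose_eq_transpose_of_trivial] at this⟩

/-- The action of `SLₙ(ℝ)` on `C/A`. -/
def actSymSpace {n : ℕ} (g : SL(n, ℝ)) : SymSpace n → SymSpace n :=
  Quotient.map (actPosCone g) (by
    rintro y z ⟨a, ha, h⟩
    refine ⟨a, ha, Subtype.ext ?_⟩
    simp [actPosCone, actSym, h])

/-- The `SLₙ(ℝ)`-invariant volume on `C/A`, normalised so that the volume of a set is the Lebesgue
measure of the part of the cone over it where `det ≤ 1`. Up to a constant, this is integration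
over `C/A ≅ {y ∈ C | det y = 1}` of the contraction of `∏_{i ≤ j} dy_{ij}` with the Euler vector
field, which is the (unique up to scaling) `SLₙ(ℝ)`-invariant volume form. -/
noncomputable def invVolume (n : ℕ) : Measure (SymSpace n) :=
  Measure.map (Quotient.mk (homothety n))
    ((Measure.comap (fun y : PosCone n => y.1) (lebesgueSym n)).restrict
      {y : PosCone n | (y.1 : Matrix (Fin n) (Fin n) ℝ).det ≤ 1})

/-! ### Cones spanned by rank one forms, orientations, and signed volumes -/

/-- The rank one symmetric matrix `v' = v ᵗv`. -/
def rankOne {n : ℕ} (v : NZVec n) : SymMat n :=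
  ⟨Matrix.of fun i j => (v.1 i : ℝ) * (v.1 j : ℝ), by
    ext i j
    simp [mul_comm]⟩

/-- The closed convex cone `s(v₁, …, v_m)` generated by `v₁', …, v_m'`. -/
def cone {n m : ℕ} (v : Fin m → NZVec n) : Set (SymMat n) :=
  {y | ∃ a : Fin m → ℝ, (∀ i, 0 ≤ a i) ∧ y = ∑ i, a i • rankOne (v i)}

/-- The image in `C/A` of a subset of `Y` (intersected with `C`). -/
def imageModA {n : ℕ} (B : Set (SymMat n)) : Set (SymSpace n) :=
  Quotient.mk (homothety n) '' {y : PosCone n | y.1 ∈ B}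

/-- The volume of the image of `B` in `C/A`. -/
noncomputable def coneVol {n : ℕ} (B : Set (SymMat n)) : ℝ :=
  (invVolume n (imageModA B)).toReal

/-- The virtual cohomological dimension `t = n(n-1)/2`; so `n + t = n(n+1)/2 = dim Y`. -/
def vcd (n : ℕ) : ℕ := n * (n - 1) / 2

/-- `v₁', …, v_d'` is a basis of `Y` inducing the orientation `o`. Equivalently, `s(v₁, …, v_d)` is
a top-dimensional simplicial cone `s`, and `v₁, …, v_d` is one of the orderings of its vertices
with `[s] = [v₁, …, v_d]`. -/
def PositivelyOrdered {n : ℕ} (o : Orientation ℝ (SymMat n) (Fin (n + vcd n)))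
    (v : Fin (n + vcd n) → NZVec n) : Prop :=
  ∃ b : Module.Basis (Fin (n + vcd n)) ℝ (SymMat n),
    (∀ i, b i = rankOne (v i)) ∧ b.orientation = o

open Classical in
/-- The signed volume `e · vol(s(v₁, …, v_d))`. -/
noncomputable def signedVol {n : ℕ} (o : Orientation ℝ (SymMat n) (Fin (n + vcd n)))
    (v : Fin (n + vcd n) → NZVec n) : ℝ :=
  (if PositivelyOrdered o v then 1 else -1) * coneVol (cone v)

/-- `[v₁, …, v_d]` is a flipon: `v₁', …, v_d'` lie in a `(d - 2)`-dimensional affine subspace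
of `Y`. -/
def IsFlipon {n : ℕ} (v : Fin (n + vcd n) → NZVec n) : Prop :=
  ∃ S : AffineSubspace ℝ (SymMat n),
    Module.finrank ℝ S.direction = n + vcd n - 2 ∧ ∀ i, rankOne (v i) ∈ S

end Sharbly

open Sharbly

/-!
The cocycle assigns to a basic sharbly the signed volume of its simplicial cone, that is, the sign of
the determinant of `(v₁', …, v_d')` in a basis of `Y` inducing the chosen orientation, times the volume
(`signedVol_eq_sign_det_mul`). Since a cone is stable under homotheties, its volume in `C/A` is its
measure under Lebesgue measure restricted to the positive definite matrices of determinant at most one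
(`truncVolume`, `invVolume_cone`), so the whole argument takes place in the vector space `Y`.

*Invariance.* The map `y ↦ g y ᵗg` has determinant `det g ^ (n + 1)` on `Y` (`det_congrSym`): this holds
for diagonal matrices by inspection, and for transvections because each is conjugate to its own square.
Hence `SLₙ(ℝ)` preserves Lebesgue measure, the determinant and the orientation.

*Finiteness.* Only linearly independent `v₁', …, v_d'` matter. In the coefficients `a` of
`y = ∑ aᵢ vᵢ'` one has to bound the volume of `{a > 0 : det y ≤ 1}`, and one may assume that `a` is
decreasing. Let `I` be the greedy basis of `ℝⁿ` extracted from `v₁, …, v_d` in this order. Then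
`det y ≥ c ∏_{i ∈ I} aᵢ` (`exists_prod_le_det`). If `v₁, …, v_m` have rank `r`, then `v₁', …, v_m'` are
independent in a space of dimension `r (r + 1) / 2`, so `m ≤ r (r + 1) / 2`, and therefore
`r > n m / d` for `0 < m < d` (`mul_lt_card_greedyBelow`). Summation by parts turns these strict
inequalities into `d ∑_I log aᵢ ≥ n ∑ log aᵢ + (max log aᵢ - min log aᵢ)`. So on the region in question
`∑ (log aᵢ + ε |log aᵢ|)` is bounded above for some `ε > 0`, which means that the indicator function of
the region is dominated by a multiple of `∏ aᵢ⁻¹ min (aᵢ, aᵢ⁻¹) ^ ε`, an integrable function.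

*Cocycle condition.* Let `u₀, …, u_d` be vectors of positive trace spanning `Y`, with the relation
`∑ αᵢ uᵢ = 0` of Cramer's rule; the signs of the `αᵢ` are the signs with which the cones over the faces
enter. The ways to write `y` as a combination of the `uᵢ` form a line in direction `α`, and `y` lies in
the cone omitting `uᵢ` iff this line meets the `i`-th facet of the nonnegative orthant. Since `α` has
entries of both signs, a line in general position that meets the orthant enters it through one facet
with `αᵢ > 0` and leaves it through one with `αᵢ < 0`, so the signed indicator functions cancel almost
everywhere (`sum_sign_indicator_conicHull`). Integrating gives `sum_signedVol_succAbove`.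

*Nonvanishing.* A flipon has linearly dependent `wᵢ'`, so its cone is a null set, while a
top-dimensional simplicial cone contains a nonempty open set of positive definite matrices of
determinant less than one (`coneVol_pos`).
-/

namespace Sharbly

/-! ### The space of symmetric matrices and its Lebesgue measure -/

/-- Entries on and above the diagonal, as linear coordinates on `Y`. -/
def symEquiv (n : ℕ) : ({p : Fin n × Fin n // p.1 ≤ p.2} → ℝ) ≃ₗ[ℝ] SymMat n where
  toFun := symOfUpper
  map_add' x y := by
    ext i j
    simp [symOfUpper]
  map_smul' a x := by
    ext i j
    simp [symOfUpper]
  invFun y p := y.1 p.1.1 p.1.2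
  left_inv x := by
    ext ⟨⟨i, j⟩, h⟩
    have h' : i ≤ j := h
    simp [symOfUpper, h']
  right_inv y := by
    ext i j
    rcases le_total i j with h | h
    · simp [symOfUpper, h]
    · simpa [symOfUpper, h] using y.2.apply i j

theorem prod_upper (n : ℕ) {M : Type*} [CommMonoid M] (f : Fin n → Fin n → M) :
    ∏ p : {p : Fin n × Fin n // p.1 ≤ p.2}, f p.1.1 p.1.2 =
      ∏ i, ∏ j ∈ Finset.Ici i, f i j := by
  rw [← Finset.prod_subtype (Finset.univ.filter fun p : Fin n × Fin n => p.1 ≤ p.2)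
    (by simp) (fun p => f p.1 p.2), Finset.prod_filter, ← Finset.univ_product_univ,
    Finset.prod_product]
  refine Finset.prod_congr rfl fun i _ => ?_
  rw [← Finset.prod_filter]
  congr 1
  ext j
  simp

/-- Every index occurs `n + 1` times among the pairs `i ≤ j`, the diagonal pairs counting twice. -/
theorem prod_upper_mul (n : ℕ) {M : Type*} [CommMonoid M] (f : Fin n → M) :
    ∏ p : {p : Fin n × Fin n // p.1 ≤ p.2}, (f p.1.1 * f p.1.2) = (∏ i, f i) ^ (n + 1) := by
  rw [prod_upper n fun i j => f i * f j]
  have h : ∏ i : Fin n, ∏ j ∈ Finset.Ici i, f j = ∏ j : Fin n, ∏ i ∈ Finset.Iic j, f j :=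
    Finset.prod_comm' (by simp)
  simp only [Finset.prod_mul_distrib]
  rw [h, ← Finset.prod_mul_distrib, ← Finset.prod_pow]
  refine Finset.prod_congr rfl fun i _ => ?_
  rw [Finset.prod_const, Finset.prod_const, ← pow_add, Fin.card_Ici, Fin.card_Iic]
  congr 1
  have := i.2
  omega

/-- The case of a constant function in `prod_upper_mul`, written additively. -/
theorem card_upper (n : ℕ) :
    2 * Fintype.card {p : Fin n × Fin n // p.1 ≤ p.2} = n * (n + 1) := by
  have := prod_upper_mul n fun _ => Multiplicative.ofAdd 1
  simp only [Finset.prod_const, Finset.card_univ, Fintype.card_fin] at this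
  have := congrArg Multiplicative.toAdd this
  simp at this
  lia

theorem two_mul_finrank_symMat (n : ℕ) :
    2 * Module.finrank ℝ (SymMat n) = n * (n + 1) := by
  rw [← card_upper, ← (symEquiv n).finrank_eq, Module.finrank_fintype_fun_eq_card]

theorem two_mul_add_vcd (n : ℕ) : 2 * (n + vcd n) = n * (n + 1) := by
  have h : 2 * vcd n = n * (n - 1) :=
    Nat.mul_div_cancel' (Nat.even_mul_pred_self n).two_dvd
  cases n with
  | zero => simp at h ⊢; exact h
  | succ m => simp at h ⊢; nlinarith

theorem finrank_symMat (n : ℕ) : Module.finrank ℝ (SymMat n) = n + vcd n := by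
  have := two_mul_finrank_symMat n
  have := two_mul_add_vcd n
  lia

theorem lebesgueSym_eq_map (n : ℕ) :
    lebesgueSym n = Measure.map (symEquiv n).toContinuousLinearEquiv volume := rfl

instance (n : ℕ) : (lebesgueSym n).IsAddHaarMeasure := by
  rw [lebesgueSym_eq_map]
  infer_instance

theorem lebesgueSym_apply {n : ℕ} (s : Set (SymMat n)) :
    lebesgueSym n s = volume (symEquiv n ⁻¹' s) :=
  (symEquiv n).toContinuousLinearEquiv.toHomeomorph.toMeasurableEquiv.map_apply s

theorem lebesgueSym_submodule {n : ℕ} (S : Submodule ℝ (SymMat n)) (hS : S ≠ ⊤) :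
    lebesgueSym n S = 0 := by
  rw [lebesgueSym_apply]
  refine Measure.addHaar_submodule volume (S.comap (symEquiv n).toLinearMap) fun h => hS ?_
  rw [eq_top_iff]
  intro y _
  have : (symEquiv n).symm y ∈ S.comap (symEquiv n).toLinearMap := h ▸ Submodule.mem_top
  simpa using this

theorem map_lebesgueSym_of_det_eq_one {n : ℕ} (f : SymMat n →ₗ[ℝ] SymMat n)
    (hf : LinearMap.det f = 1) : Measure.map f (lebesgueSym n) = lebesgueSym n := by
  set g := (symEquiv n).symm.toLinearMap ∘ₗ f ∘ₗ (symEquiv n).toLinearMap with hg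
  have hgd : LinearMap.det g = 1 := by
    rw [hg, ← hf]
    exact LinearMap.det_conj f (symEquiv n).symm
  have h := Real.map_linearMap_volume_pi_eq_smul_volume_pi (f := g) (by simp [hgd])
  rw [hgd] at h
  simp only [inv_one, abs_one, ENNReal.ofReal_one, one_smul] at h
  have mf : Measurable f := f.continuous_of_finiteDimensional.measurable
  have mg : Measurable g := g.continuous_of_finiteDimensional.measurable
  have me : Measurable (symEquiv n).toContinuousLinearEquiv :=
    (symEquiv n).toContinuousLinearEquiv.continuous.measurable
  rw [lebesgueSym_eq_map, Measure.map_map mf me]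
  conv_rhs => rw [← h, Measure.map_map me mg]
  congr 1
  ext x
  simp [hg]

/-! ### The determinant of the action on symmetric matrices -/

/-- The linear map `y ↦ g y ᵗg` between spaces of symmetric matrices, for an arbitrary rectangular
matrix `g`. -/
def congrSym {n r : ℕ} (g : Matrix (Fin n) (Fin r) ℝ) : SymMat r →ₗ[ℝ] SymMat n where
  toFun y := ⟨g * y.1 * g.transpose, by
    have hy : y.1.transpose = y.1 := y.2
    change Matrix.transpose _ = _
    simp [Matrix.transpose_mul, hy, Matrix.mul_assoc]⟩
  map_add' x y := by ext1; simp [Matrix.mul_add, Matrix.add_mul]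
  map_smul' a x := by ext1; simp

theorem congrSym_mul {n : ℕ} (g h : Matrix (Fin n) (Fin n) ℝ) :
    congrSym (g * h) = congrSym g ∘ₗ congrSym h := by
  ext1 y
  ext1
  simp [congrSym, Matrix.mul_assoc]

theorem det_congrSym_mul {n : ℕ} (g h : Matrix (Fin n) (Fin n) ℝ) :
    LinearMap.det (congrSym (g * h)) = LinearMap.det (congrSym g) * LinearMap.det (congrSym h) := by
  rw [congrSym_mul, LinearMap.det_comp]

theorem congrSym_one (n : ℕ) : congrSym (1 : Matrix (Fin n) (Fin n) ℝ) = LinearMap.id := by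
  ext1 y
  ext1
  simp [congrSym]

/-- In the coordinates `y_{ij}`, `i ≤ j`, a diagonal matrix acts diagonally. -/
theorem det_congrSym_diagonal {n : ℕ} (D : Fin n → ℝ) :
    LinearMap.det (congrSym (Matrix.diagonal D)) = (∏ i, D i) ^ (n + 1) := by
  classical
  rw [← prod_upper_mul n D, ← LinearMap.det_conj _ (symEquiv n).symm,
    ← LinearMap.det_toMatrix', ← Matrix.det_diagonal]
  congr 1
  ext p q
  rw [LinearMap.toMatrix'_apply, Matrix.diagonal_apply]
  simp only [LinearMap.comp_apply]
  change ((Matrix.diagonal D * (symEquiv n (Pi.single q 1)).1 *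
    (Matrix.diagonal D).transpose : Matrix (Fin n) (Fin n) ℝ)) p.1.1 p.1.2 = _
  rw [Matrix.diagonal_transpose, Matrix.mul_diagonal, Matrix.diagonal_mul]
  have hp := p.2
  by_cases h : p = q
  · subst h
    simp [symEquiv, symOfUpper, hp]
  · simp [symEquiv, symOfUpper, hp, h]

/-- A transvection is conjugate to its square by a diagonal matrix, so every multiplicative
invariant of it is trivial. -/
theorem det_congrSym_transvection {n : ℕ} (t : Matrix.TransvectionStruct (Fin n) ℝ) :
    LinearMap.det (congrSym t.toMatrix) = 1 := by
  obtain ⟨i, j, hij, c⟩ := t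
  rw [Matrix.TransvectionStruct.toMatrix_mk]
  -- conjugation by this diagonal matrix doubles the parameter `c`
  set D : Fin n → ℝ := Function.update 1 i 2 with hD
  have hDdet : LinearMap.det (congrSym (Matrix.diagonal D)) ≠ 0 := by
    rw [det_congrSym_diagonal]
    refine pow_ne_zero _ (Finset.prod_ne_zero_iff.2 fun k _ => ?_)
    by_cases hk : k = i
    · subst hk; simp [hD]
    · simp [hD, hk]
  have hconj : Matrix.diagonal D * Matrix.transvection i j c =
      Matrix.transvection i j c * Matrix.transvection i j c * Matrix.diagonal D := by
    rw [Matrix.transvection_mul_transvection_same i j hij]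
    ext k l
    rw [Matrix.diagonal_mul, Matrix.mul_diagonal]
    by_cases hk : k = i
    · by_cases hl : l = j
      · subst hk hl
        simp [Matrix.transvection, hij, hij.symm, hD]
        ring
      · by_cases hki : k = l
        · subst hki; simp [Matrix.transvection, Ne.symm hl]
        · simp [Matrix.transvection, Ne.symm hl, hki]
    · by_cases hki : k = l
      · subst hki; simp [Matrix.transvection, Ne.symm hk]
      · simp [Matrix.transvection, Ne.symm hk, hki]
  have h := congrArg (fun g => LinearMap.det (congrSym g)) hconj
  simp only [det_congrSym_mul] at h
  have hne : LinearMap.det (congrSym (Matrix.transvection i j c)) ≠ 0 := by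
    intro h0
    have h1 : Matrix.transvection i j c * Matrix.transvection i j (-c) = 1 := by
      rw [Matrix.transvection_mul_transvection_same i j hij]; simp
    have h2 := congrArg (fun g => LinearMap.det (congrSym g)) h1
    simp only [det_congrSym_mul, h0, congrSym_one] at h2
    simp at h2
  have h3 : LinearMap.det (congrSym (Matrix.transvection i j c)) *
      (LinearMap.det (congrSym (Matrix.diagonal D)) *
        (LinearMap.det (congrSym (Matrix.transvection i j c)) - 1)) = 0 := by
    linear_combination -h
  rcases mul_eq_zero.1 h3 with h | h
  · exact absurd h hne
  rcases mul_eq_zero.1 h with h | h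
  · exact absurd h hDdet
  · linarith

theorem det_congrSym {n : ℕ} (g : Matrix (Fin n) (Fin n) ℝ) (hg : g.det ≠ 0) :
    LinearMap.det (congrSym g) = g.det ^ (n + 1) := by
  refine Matrix.diagonal_transvection_induction_of_det_ne_zero
    (fun g => LinearMap.det (congrSym g) = g.det ^ (n + 1)) g hg (fun D _ => ?_) (fun t => ?_)
    fun A B _ _ iA iB => ?_
  · rw [det_congrSym_diagonal, Matrix.det_diagonal]
  · rw [det_congrSym_transvection, t.det, one_pow]
  · rw [det_congrSym_mul, iA, iB, Matrix.det_mul, mul_pow]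

theorem det_congrSym_SL {n : ℕ} (g : SL(n, ℝ)) :
    LinearMap.det (congrSym (g : Matrix (Fin n) (Fin n) ℝ)) = 1 := by
  rw [det_congrSym _ (by simp), g.det_coe, one_pow]

theorem actSym_eq_congrSym {n : ℕ} (g : SL(n, ℝ)) : actSym g = congrSym g.1 := rfl

/-! ### The invariant volume as a measure on symmetric matrices -/

theorem isClosed_posSemidef (n : ℕ) : IsClosed {y : SymMat n | y.1.PosSemidef} := by
  have h : {y : SymMat n | y.1.PosSemidef} =
      ⋂ x : Fin n → ℝ, {y : SymMat n | 0 ≤ x ⬝ᵥ (y.1.mulVec x)} := by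
    ext y
    simp only [Set.mem_ofPred_eq, Set.mem_iInter, Matrix.posSemidef_iff_dotProduct_mulVec,
      star_trivial]
    exact ⟨fun h => h.2, fun h => ⟨by
      rw [Matrix.IsHermitian, Matrix.conjTranspose_eq_transpose_of_trivial]
      exact y.2, h⟩⟩
  rw [h]
  refine isClosed_iInter fun x => isClosed_le continuous_const ?_
  fun_prop

theorem measurableSet_posDef (n : ℕ) : MeasurableSet {y : SymMat n | y.1.PosDef} := by
  have h : {y : SymMat n | y.1.PosDef} =
      {y : SymMat n | y.1.PosSemidef} ∩ {y : SymMat n | y.1.det ≠ 0} := by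
    ext y
    exact ⟨fun h => ⟨h.posSemidef, h.det_pos.ne'⟩, fun h => h.1.posDef_iff_det_ne_zero.2 h.2⟩
  rw [h]
  refine (isClosed_posSemidef n).measurableSet.inter (IsOpen.measurableSet ?_)
  exact isOpen_ne_fun (by fun_prop) continuous_const

theorem measurableSet_det_le_one (n : ℕ) : MeasurableSet {y : SymMat n | y.1.det ≤ 1} :=
  (isClosed_le (by fun_prop) continuous_const).measurableSet

/-- Lebesgue measure on the part of `C` where `det ≤ 1`, as a measure on `Y`. -/
noncomputable def truncVolume (n : ℕ) : Measure (SymMat n) :=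
  (lebesgueSym n).restrict {y | y.1.PosDef ∧ y.1.det ≤ 1}

theorem measurableSet_trunc (n : ℕ) :
    MeasurableSet {y : SymMat n | y.1.PosDef ∧ y.1.det ≤ 1} :=
  (measurableSet_posDef n).inter (measurableSet_det_le_one n)

theorem measurableEmbedding_posCone (n : ℕ) :
    MeasurableEmbedding (fun y : PosCone n => y.1) :=
  MeasurableEmbedding.subtype_coe (measurableSet_posDef n)

theorem measurable_mk (n : ℕ) : Measurable (Quotient.mk (homothety n)) :=
  measurable_quotient_mk''

/-- For a set `B` stable under homotheties, the preimage in `C` of its image in `C/A` is `B ∩ C`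
again, so no points are added by passing to the quotient. -/
theorem invVolume_imageModA {n : ℕ} {B : Set (SymMat n)} (hB : MeasurableSet B)
    (hs : ∀ a : ℝ, 0 < a → ∀ y ∈ B, a • y ∈ B) :
    invVolume n (imageModA B) = truncVolume n B := by
  have hpre : Quotient.mk (homothety n) ⁻¹' imageModA B = {y : PosCone n | y.1 ∈ B} := by
    ext y
    constructor
    · rintro ⟨z, hz, h⟩
      obtain ⟨a, ha, h⟩ := Quotient.exact h
      change y.1 ∈ B
      rw [h]
      exact hs a ha _ hz
    · exact fun h => ⟨y, h, rfl⟩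
  have hm : MeasurableSet {y : PosCone n | y.1 ∈ B} :=
    (measurableEmbedding_posCone n).measurable hB
  have hm' : MeasurableSet (imageModA B) := measurableSet_quotient.2 (hpre ▸ hm)
  rw [invVolume, Measure.map_apply (measurable_mk n) hm', hpre, Measure.restrict_apply hm,
    (measurableEmbedding_posCone n).comap_apply, truncVolume, Measure.restrict_apply hB]
  congr 1
  ext y
  constructor
  · rintro ⟨z, ⟨h1, h2⟩, rfl⟩
    exact ⟨h1, z.2, h2⟩
  · rintro ⟨h1, h2, h3⟩
    exact ⟨⟨y, h2⟩, ⟨h1, h3⟩, rfl⟩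

theorem det_actSym {n : ℕ} (g : SL(n, ℝ)) (y : SymMat n) : (actSym g y).1.det = y.1.det := by
  simp [actSym]

theorem measurable_actSym {n : ℕ} (g : SL(n, ℝ)) : Measurable (actSym (n := n) g) := by
  rw [actSym_eq_congrSym]
  exact (congrSym g.1).continuous_of_finiteDimensional.measurable

theorem actSym_inv_actSym {n : ℕ} (g : SL(n, ℝ)) (y : SymMat n) :
    actSym g⁻¹ (actSym g y) = y := by
  have h := congrSym_mul (g⁻¹).1 g.1
  rw [← Matrix.SpecialLinearGroup.coe_mul, inv_mul_cancel, Matrix.SpecialLinearGroup.coe_one,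
    congrSym_one] at h
  exact (LinearMap.congr_fun h y).symm

theorem posDef_actSym {n : ℕ} (g : SL(n, ℝ)) {y : SymMat n} :
    (actSym g y).1.PosDef ↔ y.1.PosDef := by
  refine ⟨fun h => ?_, fun h => (actPosCone g ⟨y, h⟩).2⟩
  have := (actPosCone g⁻¹ ⟨_, h⟩).2
  change (actSym g⁻¹ (actSym g y)).1.PosDef at this
  rwa [actSym_inv_actSym] at this

theorem map_actSym_truncVolume {n : ℕ} (g : SL(n, ℝ)) :
    Measure.map (actSym g) (truncVolume n) = truncVolume n := by
  have h : {y : SymMat n | y.1.PosDef ∧ y.1.det ≤ 1} =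
      actSym g ⁻¹' {y : SymMat n | y.1.PosDef ∧ y.1.det ≤ 1} := by
    ext y
    simp only [Set.mem_preimage, Set.mem_ofPred_eq, posDef_actSym, det_actSym]
  rw [truncVolume]
  conv_lhs => rw [h]
  rw [← Measure.restrict_map (measurable_actSym g) (measurableSet_trunc n)]
  congr 1
  exact map_lebesgueSym_of_det_eq_one _ (det_congrSym_SL g)

theorem truncVolume_image_actSym {n : ℕ} (g : SL(n, ℝ)) {B : Set (SymMat n)}
    (hB : MeasurableSet (actSym g '' B)) : truncVolume n (actSym g '' B) = truncVolume n B := by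
  conv_lhs => rw [← map_actSym_truncVolume g]
  rw [Measure.map_apply (measurable_actSym g) hB, Set.preimage_image_eq]
  exact Function.LeftInverse.injective (actSym_inv_actSym g)

theorem invVolume_eq_map (n : ℕ) : invVolume n = Measure.map (Quotient.mk (homothety n))
    (Measure.comap (fun y : PosCone n => y.1) (truncVolume n)) := by
  have e := measurableEmbedding_posCone n
  have h : (fun y : PosCone n => y.1) ⁻¹' {y | y.1.PosDef ∧ y.1.det ≤ 1} =
      {y : PosCone n | y.1.1.det ≤ 1} := by
    ext y
    exact and_iff_right y.2
  rw [invVolume, truncVolume, e.comap_restrict, h]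

theorem map_actSymSpace_invVolume {n : ℕ} (g : SL(n, ℝ)) :
    Measure.map (actSymSpace g) (invVolume n) = invVolume n := by
  have e := measurableEmbedding_posCone n
  have hg : Measurable (actPosCone (n := n) g) :=
    Measurable.subtype_mk ((measurable_actSym g).comp e.measurable)
  have hq : Measurable (actSymSpace (n := n) g) :=
    measurable_from_quotient.2 ((measurable_mk n).comp hg)
  ext s hs
  have hs' := measurable_mk n hs
  rw [Measure.map_apply hq hs]
  rw [invVolume_eq_map, Measure.map_apply (measurable_mk n) (hq hs),
    Measure.map_apply (measurable_mk n) hs, e.comap_apply, e.comap_apply]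
  have h : (fun y : PosCone n => y.1) '' (Quotient.mk (homothety n) ⁻¹' s) =
      actSym g '' ((fun y : PosCone n => y.1) ''
        (Quotient.mk (homothety n) ⁻¹' (actSymSpace g ⁻¹' s))) := by
    ext y
    constructor
    · rintro ⟨y, hy, rfl⟩
      have hy' : actPosCone g (actPosCone g⁻¹ y) = y := Subtype.ext (by
        have := actSym_inv_actSym g⁻¹ y.1
        rwa [inv_inv] at this)
      refine ⟨_, ⟨actPosCone g⁻¹ y, ?_, rfl⟩, congrArg Subtype.val hy'⟩
      change Quotient.mk _ (actPosCone g (actPosCone g⁻¹ y)) ∈ s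
      rwa [hy']
    · rintro ⟨_, ⟨y, hy, rfl⟩, rfl⟩
      exact ⟨actPosCone g y, hy, rfl⟩
  rw [h, truncVolume_image_actSym]
  rw [← h]
  exact e.measurableSet_image.2 hs'

/-! ### Cones over rank one forms -/

/-- A finitely generated cone is the image of a closed orthant under a continuous map, hence
`σ`-compact. -/
theorem measurableSet_cone {n m : ℕ} (v : Fin m → NZVec n) : MeasurableSet (cone v) := by
  have h : IsSigmaCompact (cone v) := by
    have h1 : IsSigmaCompact {a : Fin m → ℝ | ∀ i, 0 ≤ a i} := by
      refine IsSigmaCompact.of_isClosed_subset isSigmaCompact_univ ?_ (Set.subset_univ _)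
      simp only [Set.ofPred_forall]
      exact isClosed_iInter fun i => isClosed_le continuous_const (continuous_apply i)
    have h2 := h1.image (f := fun a => ∑ i, a i • rankOne (v i)) (by fun_prop)
    convert h2 using 1
    ext y
    simp [cone, eq_comm]
  obtain ⟨K, hK, hc⟩ := h
  rw [← hc]
  exact MeasurableSet.iUnion fun i => (hK i).isClosed.measurableSet

theorem smul_mem_cone {n m : ℕ} (v : Fin m → NZVec n) (a : ℝ) (ha : 0 < a) (y : SymMat n)
    (hy : y ∈ cone v) : a • y ∈ cone v := by
  obtain ⟨b, hb, rfl⟩ := hy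
  exact ⟨fun i => a * b i, fun i => mul_nonneg ha.le (hb i), by simp [Finset.smul_sum, mul_smul]⟩

theorem invVolume_cone {n m : ℕ} (v : Fin m → NZVec n) :
    invVolume n (imageModA (cone v)) = truncVolume n (cone v) :=
  invVolume_imageModA (measurableSet_cone v) (smul_mem_cone v)

theorem coneVol_cone {n m : ℕ} (v : Fin m → NZVec n) :
    coneVol (cone v) = (truncVolume n).real (cone v) := by
  rw [coneVol, invVolume_cone, Measure.real]

theorem cone_subset_span {n m : ℕ} (v : Fin m → NZVec n) :
    cone v ⊆ Submodule.span ℝ (Set.range fun i => rankOne (v i)) := by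
  rintro y ⟨a, -, rfl⟩
  exact Submodule.sum_mem _ fun i _ =>
    Submodule.smul_mem _ _ (Submodule.subset_span ⟨i, rfl⟩)

theorem truncVolume_cone_of_not_linearIndependent {n : ℕ} (v : Fin (n + vcd n) → NZVec n)
    (hv : ¬ LinearIndependent ℝ fun i => rankOne (v i)) : truncVolume n (cone v) = 0 := by
  refine le_antisymm ((Measure.restrict_apply_le _ _).trans ?_) zero_le
  refine (measure_mono (cone_subset_span v)).trans (lebesgueSym_submodule _ fun h => hv ?_).le
  refine linearIndependent_of_top_le_span_of_card_eq_finrank h.ge ?_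
  rw [finrank_symMat, Fintype.card_fin]

/-! ### The cocycle relation between indicator functions of cones -/

/-- A line meeting the nonnegative orthant, and no two of its facets at once inside the orthant,
enters the orthant through exactly one facet. -/
theorem existsUnique_entering_facet {ι : Type*} [Fintype ι] (α a : ι → ℝ)
    (hpos : ∃ i, 0 < α i)
    (hgen : ∀ t : ℝ, (∀ k, 0 ≤ a k + t * α k) → ∀ i j, a i + t * α i = 0 →
      a j + t * α j = 0 → i = j)
    (hP : ∃ t : ℝ, ∀ k, 0 ≤ a k + t * α k) :
    ∃! i, 0 < α i ∧ ∃ t : ℝ, (∀ k, 0 ≤ a k + t * α k) ∧ a i + t * α i = 0 := by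
  classical
  obtain ⟨i₁, hi₁⟩ := hpos
  obtain ⟨t₁, ht₁⟩ := hP
  -- the entering time is the largest of the times at which a coordinate becomes nonnegative
  obtain ⟨i, hi, hmax⟩ := Finset.exists_max_image (Finset.univ.filter fun i => 0 < α i)
    (fun i => -a i / α i) ⟨i₁, by simpa using hi₁⟩
  simp only [Finset.mem_filter, Finset.mem_univ, true_and] at hi hmax
  refine ⟨i, ⟨hi, -a i / α i, fun k => ?_, by field_simp; ring⟩, ?_⟩
  · rcases lt_or_ge 0 (α k) with hk | hk
    · have := (div_le_iff₀ hk).1 (hmax k hk)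
      linarith
    · have h1 : -a i / α i ≤ t₁ := by
        rw [div_le_iff₀ hi]
        linarith [ht₁ i]
      nlinarith [ht₁ k]
  · rintro j ⟨hj, t, ht, hjt⟩
    have hi0 : a i + (-a i / α i) * α i = 0 := by field_simp; ring
    have h1 : -a j / α j = t := by
      rw [div_eq_iff hj.ne']
      linarith
    have h2 : t ≤ -a i / α i := h1 ▸ hmax j hj
    have h3 : -a i / α i ≤ t := by
      rw [div_le_iff₀ hi]
      linarith [ht i]
    refine hgen t ht j i hjt ?_
    rw [le_antisymm h2 h3]
    exact hi0

open Classical in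
/-- A line whose direction has entries of both signs enters the orthant and leaves it again, each
through one facet; the signs of the corresponding entries of the direction are opposite. -/
theorem sum_sign_facets_eq_zero {ι : Type*} [Fintype ι] (α a : ι → ℝ)
    (hpos : ∃ i, 0 < α i) (hneg : ∃ i, α i < 0)
    (hgen : ∀ t : ℝ, (∀ k, 0 ≤ a k + t * α k) → ∀ i j, a i + t * α i = 0 →
      a j + t * α j = 0 → i = j) :
    ∑ i, ((SignType.sign (α i) : SignType) : ℝ) *
      (if ∃ t : ℝ, (∀ k, 0 ≤ a k + t * α k) ∧ a i + t * α i = 0 then 1 else 0) = 0 := by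
  by_cases hP : ∃ t : ℝ, ∀ k, 0 ≤ a k + t * α k
  · obtain ⟨i, hi, hi'⟩ := existsUnique_entering_facet α a hpos hgen hP
    obtain ⟨j, hj, hj'⟩ := existsUnique_entering_facet (fun k => -α k) a
      (by simpa using hneg)
      (fun t ht i j h1 h2 => hgen (-t) (fun k => by simpa using ht k) i j
        (by simpa using h1) (by simpa using h2))
      (by
        obtain ⟨t, ht⟩ := hP
        exact ⟨-t, fun k => by simpa using ht k⟩)
    have hflip : ∀ k, (∃ t : ℝ, (∀ k, 0 ≤ a k + t * -α k) ∧ a k + t * -α k = 0) ↔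
        ∃ t : ℝ, (∀ k, 0 ≤ a k + t * α k) ∧ a k + t * α k = 0 := fun k =>
      ⟨fun ⟨t, h⟩ => ⟨-t, by simpa using h⟩, fun ⟨t, h⟩ => ⟨-t, by simpa using h⟩⟩
    simp only [hflip] at hj hj'
    have hij : i ≠ j := by
      rintro rfl
      linarith [hi.1, hj.1]
    rw [Finset.sum_eq_add_of_mem i j (Finset.mem_univ _) (Finset.mem_univ _) hij]
    · rw [if_pos hi.2, if_pos hj.2, sign_pos hi.1, sign_neg (by linarith [hj.1])]
      simp
    · rintro k - ⟨hki, hkj⟩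
      by_cases hk : ∃ t : ℝ, (∀ l, 0 ≤ a l + t * α l) ∧ a k + t * α k = 0
      · rcases lt_trichotomy (α k) 0 with h | h | h
        · exact absurd (hj' k ⟨by linarith, hk⟩) hkj
        · simp [h]
        · exact absurd (hi' k ⟨h, hk⟩) hki
      · rw [if_neg hk, mul_zero]
  · refine Finset.sum_eq_zero fun i _ => ?_
    rw [if_neg, mul_zero]
    rintro ⟨t, ht, -⟩
    exact hP ⟨t, ht⟩

section Module

variable {d : ℕ} {V : Type*} [AddCommGroup V] [Module ℝ V]

/-- The coefficients of the linear relation between `d + 1` vectors in dimension `d` that is given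
by Cramer's rule. -/
noncomputable def cramerCoeff (b : Module.Basis (Fin d) ℝ V) (u : Fin (d + 1) → V)
    (i : Fin (d + 1)) : ℝ :=
  (-1) ^ (i : ℕ) * b.det (u ∘ i.succAbove)

theorem sum_cramerCoeff_smul (b : Module.Basis (Fin d) ℝ V) (u : Fin (d + 1) → V) :
    ∑ i, cramerCoeff b u i • u i = 0 := by
  refine b.repr.injective ?_
  ext k
  rw [map_sum, Finsupp.finsetSum_apply]
  simp only [map_smul, Finsupp.smul_apply, map_zero, Finsupp.zero_apply, smul_eq_mul]
  -- the `k`-th coordinate is the determinant of a matrix with two equal rows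
  set A : Matrix (Fin (d + 1)) (Fin (d + 1)) ℝ :=
    Matrix.of (Fin.cons (fun j => b.repr (u j) k) fun l j => b.repr (u j) l) with hA
  have h0 : A.det = 0 := by
    refine Matrix.det_zero_of_row_eq (i := 0) (j := k.succ) (Fin.succ_ne_zero k).symm ?_
    ext j
    simp [hA]
  rw [← h0, Matrix.det_succ_row_zero]
  refine Finset.sum_congr rfl fun i _ => ?_
  have h1 : A.submatrix Fin.succ i.succAbove = b.toMatrix (u ∘ i.succAbove) := by
    ext l j
    simp [hA, Module.Basis.toMatrix_apply]
  rw [h1, cramerCoeff, Module.Basis.det_apply]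
  simp [hA]
  ring

theorem linearIndependent_of_det_ne_zero (b : Module.Basis (Fin d) ℝ V) {w : Fin d → V}
    (h : b.det w ≠ 0) : LinearIndependent ℝ w :=
  ((Module.Basis.is_basis_iff_det b).2 (isUnit_iff_ne_zero.2 h)).1

/-- The convex cone generated by a finite family of vectors, in an arbitrary real vector space;
`cone v` is by definition the case of the family of rank one forms `vᵢ'`. -/
def conicHull {m : ℕ} (u : Fin m → V) : Set V :=
  {y | ∃ a : Fin m → ℝ, (∀ i, 0 ≤ a i) ∧ y = ∑ i, a i • u i}

theorem mem_conicHull_succAbove_iff (b : Module.Basis (Fin d) ℝ V) (u : Fin (d + 1) → V)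
    (a : Fin (d + 1) → ℝ) (i : Fin (d + 1)) (hi : cramerCoeff b u i ≠ 0) :
    (∑ k, a k • u k) ∈ conicHull (u ∘ i.succAbove) ↔
      ∃ t : ℝ, (∀ k, 0 ≤ a k + t * cramerCoeff b u k) ∧ a i + t * cramerCoeff b u i = 0 := by
  have hrel := sum_cramerCoeff_smul b u
  constructor
  · rintro ⟨c, hc, h⟩
    -- the given nonnegative combination is the point of the line with `i`-th coordinate zero
    set β : Fin (d + 1) → ℝ := i.insertNth 0 c with hβ
    set t := -a i / cramerCoeff b u i with ht
    have hti : a i + t * cramerCoeff b u i = 0 := by rw [ht]; field_simp; ring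
    have hβu : ∑ k, β k • u k = ∑ k, a k • u k := by
      rw [h, Fin.sum_univ_succAbove _ i]
      simp [hβ]
    have hsum : ∑ k, (β k - (a k + t * cramerCoeff b u k)) • u k = 0 := by
      simp only [sub_smul, add_smul, mul_smul, Finset.sum_sub_distrib, Finset.sum_add_distrib]
      rw [← Finset.smul_sum, hrel, hβu]
      simp
    have hzero : ∀ j, β (i.succAbove j) -
        (a (i.succAbove j) + t * cramerCoeff b u (i.succAbove j)) = 0 := by
      have hli := linearIndependent_of_det_ne_zero b (w := u ∘ i.succAbove)
        (fun h => hi (by rw [cramerCoeff, h, mul_zero]))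
      refine Fintype.linearIndependent_iff.1 hli _ ?_
      rw [Fin.sum_univ_succAbove _ i, hti] at hsum
      simpa [hβ] using hsum
    refine ⟨t, fun k => ?_, hti⟩
    induction k using i.succAboveCases with
    | x => exact hti.ge
    | p j =>
      have h1 := hzero j
      have h2 : β (i.succAbove j) = c j := by simp [hβ]
      linarith [hc j]
  · rintro ⟨t, ht, hti⟩
    refine ⟨fun j => a (i.succAbove j) + t * cramerCoeff b u (i.succAbove j),
      fun j => ht _, ?_⟩
    have h : ∑ k, (a k + t * cramerCoeff b u k) • u k = ∑ k, a k • u k := by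
      simp only [add_smul, mul_smul, Finset.sum_add_distrib]
      rw [← Finset.smul_sum, hrel, smul_zero, add_zero]
    rw [← h, Fin.sum_univ_succAbove _ i, hti]
    simp

open Classical in
/-- Away from the hyperplanes through `d - 1` of the vectors, the signed indicator functions of
the cones over the faces of a `d`-simplex add up to zero, if the vectors lie in an open half
space. -/
theorem sum_sign_indicator_conicHull (b : Module.Basis (Fin d) ℝ V) (u : Fin (d + 1) → V)
    (τ : V →ₗ[ℝ] ℝ) (hτ : ∀ i, 0 < τ (u i)) (y : V)
    (hy : ∀ i j, i ≠ j → y ∉ Submodule.span ℝ (u '' {k | k ≠ i ∧ k ≠ j})) :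
    ∑ i, ((SignType.sign (cramerCoeff b u i) : SignType) : ℝ) *
      (if y ∈ conicHull (u ∘ i.succAbove) then 1 else 0) = 0 := by
  by_cases h0 : ∀ i, cramerCoeff b u i = 0
  · simp [h0]
  push Not at h0
  obtain ⟨i₀, hi₀⟩ := h0
  obtain ⟨a, rfl⟩ : ∃ a : Fin (d + 1) → ℝ, ∑ k, a k • u k = y := by
    have hspan := ((Module.Basis.is_basis_iff_det b (v := u ∘ i₀.succAbove)).2
      (isUnit_iff_ne_zero.2 fun h => hi₀ (by rw [cramerCoeff, h, mul_zero]))).2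
    have hy' : y ∈ Submodule.span ℝ (Set.range u) :=
      Submodule.span_mono (Set.range_comp_subset_range _ _) (hspan ▸ Submodule.mem_top)
    exact (Submodule.mem_span_range_iff_exists_fun ℝ).1 hy'
  have hrel := sum_cramerCoeff_smul b u
  have hτrel : ∑ i, cramerCoeff b u i * τ (u i) = 0 := by
    simpa using congrArg τ hrel
  -- pairing the relation with `τ` shows that it has coefficients of both signs
  have hboth : (∃ i, 0 < cramerCoeff b u i) ∧ ∃ i, cramerCoeff b u i < 0 := by
    constructor
    · by_contra! h
      have := (Finset.sum_eq_zero_iff_of_nonpos fun i _ =>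
        mul_nonpos_of_nonpos_of_nonneg (h i) (hτ i).le).1 hτrel i₀ (Finset.mem_univ _)
      exact (mul_ne_zero hi₀ (hτ i₀).ne') this
    · by_contra! h
      have := (Finset.sum_eq_zero_iff_of_nonneg fun i _ =>
        mul_nonneg (h i) (hτ i).le).1 hτrel i₀ (Finset.mem_univ _)
      exact (mul_ne_zero hi₀ (hτ i₀).ne') this
  refine Eq.trans (Finset.sum_congr rfl fun i _ => ?_)
    (sum_sign_facets_eq_zero (cramerCoeff b u) a hboth.1 hboth.2 ?_)
  · by_cases hi : cramerCoeff b u i = 0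
    · simp [hi]
    · simp only [mem_conicHull_succAbove_iff b u a i hi]
  · intro t ht i j hi hj
    by_contra hij
    refine hy i j hij ?_
    have h : ∑ k, (a k + t * cramerCoeff b u k) • u k = ∑ k, a k • u k := by
      simp only [add_smul, mul_smul, Finset.sum_add_distrib]
      rw [← Finset.smul_sum, hrel, smul_zero, add_zero]
    rw [← h]
    refine Submodule.sum_mem _ fun k _ => ?_
    by_cases hki : k = i
    · rw [hki, hi, zero_smul]; exact Submodule.zero_mem _
    by_cases hkj : k = j
    · rw [hkj, hj, zero_smul]; exact Submodule.zero_mem _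
    · exact Submodule.smul_mem _ _ (Submodule.subset_span ⟨k, ⟨hki, hkj⟩, rfl⟩)

theorem span_omit_two_ne_top (b : Module.Basis (Fin d) ℝ V) (u : Fin (d + 1) → V)
    {i j : Fin (d + 1)} (hij : i ≠ j) :
    Submodule.span ℝ (u '' {k | k ≠ i ∧ k ≠ j}) ≠ ⊤ := by
  classical
  intro h
  have hfin : Module.finrank ℝ V = d := by simpa using Module.finrank_eq_card_basis b
  have hset : u '' {k | k ≠ i ∧ k ≠ j} =
      (((Finset.univ.erase i).erase j).image u : Finset V) := by
    ext y
    simp [and_comm]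
  have h1 := finrank_span_finset_le_card (R := ℝ) (((Finset.univ.erase i).erase j).image u)
  rw [Set.finrank, ← hset, h, finrank_top, hfin] at h1
  have h2 := Finset.card_image_le (s := (Finset.univ.erase i).erase j) (f := u)
  have h3 : ((Finset.univ.erase i).erase j).card = d - 1 := by
    rw [Finset.card_erase_of_mem (by simp [hij.symm]), Finset.card_erase_of_mem (by simp)]
    simp
  have h4 : 0 < d := by
    rcases Nat.eq_zero_or_pos d with rfl | h
    · exact absurd (Subsingleton.elim (α := Fin 1) i j) hij
    · exact h
  omega

end Module

/-! ### Greedy bases -/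

section Greedy

variable {d : ℕ} {V : Type*} [AddCommGroup V] [Module ℝ V]

open Classical in
/-- The greedy basis of an ordered family of vectors: the indices at which the span grows. -/
noncomputable def greedy (u : Fin d → V) : Finset (Fin d) :=
  Finset.univ.filter fun j => u j ∉ Submodule.span ℝ (u '' {i | i < j})

/-- The indices of the greedy basis among the first `m` indices. -/
noncomputable def greedyBelow (u : Fin d → V) (m : ℕ) : Finset (Fin d) :=
  (greedy u).filter fun j => (j : ℕ) < m

/-- The greedy basis vectors among the first `m` vectors are a basis of the span of the latter. -/
theorem greedyBelow_spec (u : Fin d → V) (m : ℕ) :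
    LinearIndepOn ℝ u (greedyBelow u m : Set (Fin d)) ∧
      ∀ i : Fin d, (i : ℕ) < m → u i ∈ Submodule.span ℝ (u '' (greedyBelow u m)) := by
  classical
  induction m with
  | zero => simp [greedyBelow]
  | succ m ih =>
    obtain ⟨ih1, ih2⟩ := ih
    by_cases hm : m < d
    · have hspan : Submodule.span ℝ (u '' {i | i < (⟨m, hm⟩ : Fin d)}) =
          Submodule.span ℝ (u '' (greedyBelow u m)) := by
        refine le_antisymm (Submodule.span_le.2 ?_) (Submodule.span_mono (Set.image_mono ?_))
        · rintro _ ⟨i, hi, rfl⟩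
          exact ih2 i hi
        · intro i hi
          simp only [greedyBelow, Finset.coe_filter] at hi
          exact hi.2
      by_cases hg : (⟨m, hm⟩ : Fin d) ∈ greedy u
      · have hins : greedyBelow u (m + 1) = insert ⟨m, hm⟩ (greedyBelow u m) := by
          ext j
          simp only [greedyBelow, Finset.mem_filter, Finset.mem_insert]
          constructor
          · rintro ⟨h1, h2⟩
            by_cases hj : (j : ℕ) = m
            · exact Or.inl (Fin.ext hj)
            · exact Or.inr ⟨h1, by omega⟩
          · rintro (rfl | ⟨h1, h2⟩)
            · exact ⟨hg, by simp⟩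
            · exact ⟨h1, by omega⟩
        have hg' : u ⟨m, hm⟩ ∉ Submodule.span ℝ (u '' (greedyBelow u m)) := by
          rw [← hspan]
          simpa [greedy] using hg
        rw [hins, Finset.coe_insert]
        refine ⟨ih1.insert hg', fun i hi => ?_⟩
        by_cases him : (i : ℕ) = m
        · exact Submodule.subset_span ⟨i, Or.inl (Fin.ext him), rfl⟩
        · exact Submodule.span_mono (Set.image_mono (Set.subset_insert _ _)) (ih2 i (by omega))
      · have heq : greedyBelow u (m + 1) = greedyBelow u m := by
          ext j
          simp only [greedyBelow, Finset.mem_filter]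
          constructor
          · rintro ⟨h1, h2⟩
            refine ⟨h1, ?_⟩
            by_contra hj
            have : j = ⟨m, hm⟩ := Fin.ext (by simp; omega)
            exact hg (this ▸ h1)
          · exact fun ⟨h1, h2⟩ => ⟨h1, by omega⟩
        rw [heq]
        refine ⟨ih1, fun i hi => ?_⟩
        by_cases him : (i : ℕ) = m
        · have : u ⟨m, hm⟩ ∈ Submodule.span ℝ (u '' {i | i < (⟨m, hm⟩ : Fin d)}) := by
            simpa [greedy] using hg
          rw [hspan] at this
          rwa [show i = ⟨m, hm⟩ from Fin.ext him]
        · exact ih2 i (by omega)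
    · have heq : greedyBelow u (m + 1) = greedyBelow u m := by
        ext j
        simp only [greedyBelow, Finset.mem_filter]
        have := j.2
        constructor <;> exact fun ⟨h1, h2⟩ => ⟨h1, by omega⟩
      rw [heq]
      exact ⟨ih1, fun i hi => ih2 i (by have := i.2; omega)⟩

end Greedy

/-- The rank one symmetric matrix `x ᵗx` of a real vector. -/
def rankOneReal {n : ℕ} (x : Fin n → ℝ) : SymMat n :=
  ⟨Matrix.vecMulVec x x, by
    ext i j
    simp [Matrix.vecMulVec_apply, mul_comm]⟩

theorem congrSym_rankOneReal {n r : ℕ} (B : Matrix (Fin n) (Fin r) ℝ) (c : Fin r → ℝ) :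
    congrSym B (rankOneReal c) = rankOneReal (B.mulVec c) := by
  ext1
  simp [congrSym, rankOneReal, Matrix.mul_vecMulVec, Matrix.vecMulVec_mul, Matrix.vecMul_transpose]

/-- Linearly independent squares of vectors from an `r`-dimensional space number at most
`dim Sym² = r (r + 1) / 2`. -/
theorem card_le_of_linearIndependent_rankOneReal {n : ℕ} {κ ι : Type*} [Fintype κ] [Fintype ι]
    (x : κ → Fin n → ℝ) (w : ι → Fin n → ℝ)
    (hx : LinearIndependent ℝ fun k => rankOneReal (x k))
    (hw : ∀ k, x k ∈ Submodule.span ℝ (Set.range w)) :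
    2 * Fintype.card κ ≤ Fintype.card ι * (Fintype.card ι + 1) := by
  set r := Fintype.card ι
  let e : Fin r ≃ ι := (Fintype.equivFin ι).symm
  let B : Matrix (Fin n) (Fin r) ℝ := Matrix.of fun i j => w (e j) i
  have hB : ∀ k, ∃ c : Fin r → ℝ, B.mulVec c = x k := by
    intro k
    obtain ⟨c, hc⟩ := (Submodule.mem_span_range_iff_exists_fun ℝ).1 (hw k)
    refine ⟨c ∘ e, ?_⟩
    rw [← hc, ← e.sum_comp]
    ext i
    simp [B, Matrix.mulVec, dotProduct, Finset.sum_apply, mul_comm]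
  choose c hc using hB
  have hli : LinearIndependent ℝ fun k => rankOneReal (c k) := by
    refine LinearIndependent.of_comp (congrSym B) ?_
    convert hx using 2 with k
    rw [Function.comp_apply, congrSym_rankOneReal, hc]
  have := hli.fintype_card_le_finrank
  have := two_mul_finrank_symMat r
  omega

theorem two_mul_le_card_greedyBelow {n d : ℕ} (u : Fin d → Fin n → ℝ)
    (hu : LinearIndependent ℝ fun i => rankOneReal (u i)) {m : ℕ} (hm : m ≤ d) :
    2 * m ≤ (greedyBelow u m).card * ((greedyBelow u m).card + 1) := by
  have h := card_le_of_linearIndependent_rankOneReal (fun k : Fin m => u (Fin.castLE hm k))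
    (fun i : greedyBelow u m => u i) (hu.comp _ (Fin.castLE_injective hm)) fun k => by
      have := (greedyBelow_spec u m).2 (Fin.castLE hm k) (by simp)
      rwa [Set.image_eq_range] at this
  simpa using h

theorem card_greedyBelow_le {n d : ℕ} (u : Fin d → Fin n → ℝ) (m : ℕ) :
    (greedyBelow u m).card ≤ n := by
  have h := (greedyBelow_spec u m).1.linearIndependent.fintype_card_le_finrank
  simpa using h

theorem greedyBelow_self {d : ℕ} {V : Type*} [AddCommGroup V] [Module ℝ V] (u : Fin d → V) :
    greedyBelow u d = greedy u := by
  simp [greedyBelow]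

theorem card_greedy {n d : ℕ} (hd : 2 * d = n * (n + 1)) (u : Fin d → Fin n → ℝ)
    (hu : LinearIndependent ℝ fun i => rankOneReal (u i)) : (greedy u).card = n := by
  have h1 := two_mul_le_card_greedyBelow u hu le_rfl
  have h2 := card_greedyBelow_le u d
  rw [greedyBelow_self] at h1 h2
  refine le_antisymm h2 ?_
  by_contra! h
  nlinarith

/-- The strict inequality that makes the volumes finite: a proper initial segment of `m` vectors
has rank larger than its share `n m / d`. -/
theorem mul_lt_card_greedyBelow {n d : ℕ} (hd : 2 * d = n * (n + 1)) (u : Fin d → Fin n → ℝ)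
    (hu : LinearIndependent ℝ fun i => rankOneReal (u i)) {m : ℕ} (h0 : 0 < m) (hm : m < d) :
    n * m + 1 ≤ d * (greedyBelow u m).card := by
  have h1 := two_mul_le_card_greedyBelow u hu hm.le
  have h2 := card_greedyBelow_le u m
  set r := (greedyBelow u m).card
  have hr : 0 < r := by
    by_contra! h
    have : r = 0 := by omega
    rw [this] at h1
    omega
  rcases h2.lt_or_eq with h | h
  · have h3 : n * (2 * m) ≤ n * (r * (r + 1)) := Nat.mul_le_mul_left n h1
    have h4 : n * r * (r + 1) + 1 ≤ n * r * (n + 1) := by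
      have : n * r * (r + 1) < n * r * (n + 1) :=
        Nat.mul_lt_mul_of_pos_left (by omega) (Nat.mul_pos (by omega) hr)
      omega
    have h5 : 2 * (d * r) = n * r * (n + 1) := by
      rw [← mul_assoc, hd]; ring
    nlinarith
  · rw [h]
    nlinarith

/-! ### Summation by parts -/

/-- Abel summation for weights with nonnegative partial sums. -/
theorem last_mul_sum_le_sum_mul {D : ℕ} (x w : Fin (D + 1) → ℝ) (hx : Antitone x)
    (hw : ∀ m ≤ D, 0 ≤ ∑ i : Fin (D + 1) with i.val < m, w i) :
    x (Fin.last D) * ∑ i, w i ≤ ∑ i, w i * x i := by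
  induction D with
  | zero => simp [mul_comm (x 0)]
  | succ D ih =>
    have hcs : ∀ m ≤ D + 1, ∑ i : Fin (D + 2) with i.val < m, w i =
        ∑ i : Fin (D + 1) with i.val < m, w i.castSucc := by
      intro m hm
      rw [Finset.sum_filter, Finset.sum_filter, Fin.sum_univ_castSucc]
      simp [hm]
    have h1 := ih (fun i => x i.castSucc) (fun i => w i.castSucc)
      (hx.comp_monotone Fin.strictMono_castSucc.monotone)
      fun m hm => by rw [← hcs m (by omega)]; exact hw m (by omega)
    have h2 := hw (D + 1) le_rfl
    rw [hcs _ le_rfl] at h2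
    have h3 : (Finset.univ.filter fun i : Fin (D + 1) => (i : ℕ) < D + 1) = Finset.univ := by
      ext i
      simp only [Finset.mem_filter, Finset.mem_univ, true_and, iff_true]
      exact i.2
    rw [h3] at h2
    rw [Fin.sum_univ_castSucc w, Fin.sum_univ_castSucc fun i => w i * x i]
    have h4 : x (Fin.last (D + 1)) ≤ x (Fin.last D).castSucc := hx (Fin.le_last _)
    nlinarith

/-- If every proper initial segment contains more than its share of `I`, then the average of an
antitone function over `I` exceeds its overall average, by a multiple of the oscillation. -/
theorem sum_add_sub_le_of_antitone {d n : ℕ} (I : Finset (Fin d)) (hI : I.card = n)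
    (h : ∀ m, 0 < m → m < d → n * m + 1 ≤ d * (I.filter fun i : Fin d => (i : ℕ) < m).card)
    (x : Fin d → ℝ) (hx : Antitone x) (p q : Fin d) :
    n * ∑ i, x i + (x p - x q) ≤ d * ∑ i ∈ I, x i := by
  classical
  obtain ⟨D, rfl⟩ : ∃ D, d = D + 1 := ⟨d - 1, by have := p.2; omega⟩
  -- The last two terms of the weights take the oscillation into account. The partial sums stay
  -- nonnegative because the hypothesis is strict.
  set w : Fin (D + 1) → ℝ := fun i => (if i ∈ I then ((D + 1 : ℕ) : ℝ) else 0) - n -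
    (if i = 0 then 1 else 0) + (if i = Fin.last D then 1 else 0) with hw
  have hpart : ∀ m ≤ D, 0 ≤ ∑ i : Fin (D + 1) with i.val < m, w i := by
    intro m hm
    rcases Nat.eq_zero_or_pos m with rfl | hm0
    · simp
    have h1 := h m hm0 (by omega)
    have h2 : ∑ i : Fin (D + 1) with i.val < m, (if i ∈ I then ((D + 1 : ℕ) : ℝ) else 0) =
        ((D + 1 : ℕ) : ℝ) * (I.filter fun i : Fin (D + 1) => (i : ℕ) < m).card := by
      rw [← Finset.sum_filter, Finset.filter_filter, Finset.sum_const, nsmul_eq_mul, mul_comm]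
      congr 3
      ext i
      simp [and_comm]
    have h3 : ((Finset.univ.filter fun i : Fin (D + 1) => (i : ℕ) < m).card : ℝ) = m := by
      rw [Fin.card_filter_val_lt, min_eq_right (by omega)]
    have h4 : (n * m + 1 : ℝ) ≤ ((D + 1 : ℕ) : ℝ) * (I.filter fun i : Fin (D + 1) => (i : ℕ) < m).card := by
      exact_mod_cast h1
    simp only [hw, Finset.sum_add_distrib, Finset.sum_sub_distrib]
    rw [h2, Finset.sum_const, nsmul_eq_mul, h3, Finset.sum_ite_eq_of_mem' _ _ _ (by simpa using hm0),
      Finset.sum_ite_eq', if_neg (by simpa using hm)]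
    linarith
  have htot : ∑ i, w i = 0 := by
    simp only [hw, Finset.sum_add_distrib, Finset.sum_sub_distrib]
    simp [Finset.sum_ite_mem, hI]
    ring
  have key := last_mul_sum_le_sum_mul x w hx hpart
  rw [htot, mul_zero] at key
  simp only [hw, add_mul, sub_mul, Finset.sum_add_distrib, Finset.sum_sub_distrib, ite_mul,
    zero_mul, one_mul, Finset.sum_ite_eq', Finset.mem_univ, if_true, Finset.sum_ite_mem,
    Finset.univ_inter] at key
  rw [← Finset.mul_sum, ← Finset.mul_sum] at key
  have h1 : x p ≤ x 0 := hx (Fin.zero_le p)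
  have h2 : x (Fin.last D) ≤ x q := hx (Fin.le_last q)
  linarith

/-! ### A lower bound for the determinant on a simplicial cone -/

/-- A consequence of the matrix determinant lemma. -/
theorem det_le_det_add_vecMulVec {n : ℕ} {A : Matrix (Fin n) (Fin n) ℝ} (hA : A.PosDef)
    (x : Fin n → ℝ) {a : ℝ} (ha : 0 ≤ a) : A.det ≤ (A + a • Matrix.vecMulVec x x).det := by
  have h1 : a • Matrix.vecMulVec x x =
      Matrix.replicateCol Unit (a • x) * Matrix.replicateRow Unit x := by
    ext i j
    simp [Matrix.vecMulVec_apply, Matrix.mul_apply, mul_assoc]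
  rw [h1, Matrix.det_add_replicateCol_mul_replicateRow (isUnit_iff_ne_zero.2 hA.det_pos.ne'),
    Matrix.det_unique (1 + _)]
  have h2 : (Matrix.replicateRow Unit x * A⁻¹ * Matrix.replicateCol Unit (a • x)) default default =
      a * (x ⬝ᵥ A⁻¹.mulVec x) := by
    rw [Matrix.dotProduct_mulVec]
    simp [Matrix.mul_apply, Matrix.vecMul, dotProduct, Finset.mul_sum]
    refine Finset.sum_congr rfl fun i _ => by ring
  have h3 : 0 ≤ x ⬝ᵥ A⁻¹.mulVec x := by
    simpa using hA.inv.posSemidef.dotProduct_mulVec_nonneg x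
  rw [Matrix.add_apply, h2]
  simp only [Matrix.one_apply_eq]
  have := hA.det_pos
  nlinarith [mul_nonneg ha h3]

theorem posSemidef_vecMulVec {n : ℕ} (x : Fin n → ℝ) : (Matrix.vecMulVec x x).PosSemidef := by
  simpa using Matrix.posSemidef_vecMulVec_self_star x

/-- One term of the Cauchy–Binet expansion of the determinant of `∑ aᵢ xᵢ ᵗxᵢ`, as a lower
bound. -/
theorem exists_prod_le_det {n d : ℕ} (u : Fin d → Fin n → ℝ) (I : Finset (Fin d))
    (hcard : I.card = n) (hI : LinearIndepOn ℝ u (I : Set (Fin d))) :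
    ∃ c : ℝ, 0 < c ∧ ∀ a : Fin d → ℝ, (∀ i, 0 < a i) →
      c * ∏ i ∈ I, a i ≤ (∑ i, a i • Matrix.vecMulVec (u i) (u i)).det := by
  classical
  let e : Fin n ≃ I := (I.equivFinOfCardEq hcard).symm
  let B : Matrix (Fin n) (Fin n) ℝ := Matrix.of fun i j => u (e j) i
  have hB : B.det ≠ 0 := by
    have h : LinearIndependent ℝ B.col := by
      have := hI.linearIndependent.comp e e.injective
      exact this
    exact (B.isUnit_iff_isUnit_det.1 (Matrix.linearIndependent_cols_iff_isUnit.1 h)).ne_zero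
  refine ⟨B.det ^ 2, by positivity, fun a ha => ?_⟩
  have hsum : ∑ i ∈ I, a i • Matrix.vecMulVec (u i) (u i) =
      B * Matrix.diagonal (fun j => a (e j)) * B.transpose := by
    rw [← Finset.sum_coe_sort, ← e.sum_comp]
    ext i j
    rw [Matrix.mul_apply]
    simp only [Matrix.sum_apply, Matrix.smul_apply, Matrix.vecMulVec_apply,
      Matrix.mul_diagonal, B, Matrix.of_apply, Matrix.transpose_apply, smul_eq_mul]
    exact Finset.sum_congr rfl fun k _ => by ring
  have hprod : ∏ i ∈ I, a i = ∏ j, a (e j) := by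
    rw [← Finset.prod_coe_sort, ← e.prod_comp]
  have hdet : (∑ i ∈ I, a i • Matrix.vecMulVec (u i) (u i)).det = B.det ^ 2 * ∏ i ∈ I, a i := by
    rw [hsum, Matrix.det_mul, Matrix.det_mul, Matrix.det_diagonal, Matrix.det_transpose, hprod]
    ring
  have hpsd : ∀ J : Finset (Fin d), (∑ i ∈ J, a i • Matrix.vecMulVec (u i) (u i)).PosSemidef :=
    fun J => Matrix.posSemidef_sum J fun i _ => (posSemidef_vecMulVec (u i)).smul (ha i).le
  have hpd : (∑ i ∈ I, a i • Matrix.vecMulVec (u i) (u i)).PosDef := by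
    refine (hpsd I).posDef_iff_det_ne_zero.2 ?_
    rw [hdet]
    exact mul_ne_zero (pow_ne_zero 2 hB) (Finset.prod_pos fun i _ => ha i).ne'
  -- the remaining rank one terms are added one by one
  have hJ : ∀ J : Finset (Fin d), Disjoint J I →
      (∑ i ∈ I, a i • Matrix.vecMulVec (u i) (u i)).det ≤
        (∑ i ∈ J ∪ I, a i • Matrix.vecMulVec (u i) (u i)).det := by
    intro J
    induction J using Finset.induction_on with
    | empty => simp
    | insert j J hj ih =>
      intro hd
      rw [Finset.disjoint_insert_left] at hd
      have hj' : j ∉ J ∪ I := by simp [hj, hd.1]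
      have hpdJ : (∑ i ∈ J ∪ I, a i • Matrix.vecMulVec (u i) (u i)).PosDef := by
        rw [Finset.sum_union hd.2, add_comm]
        exact hpd.add_posSemidef (hpsd J)
      rw [Finset.insert_union, Finset.sum_insert hj', add_comm]
      exact (ih hd.2).trans (det_le_det_add_vecMulVec hpdJ _ (ha j).le)
  have := hJ Iᶜ disjoint_compl_left
  rw [Finset.union_comm, Finset.union_compl] at this
  rw [← hdet]
  exact this

/-! ### Finiteness of the volumes -/

/-- The one-variable majorant `t⁻¹ min (t, t⁻¹) ^ ε` on `t > 0`, extended by zero. -/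
noncomputable def majorant (ε t : ℝ) : ℝ :=
  if 0 < t then Real.exp (-Real.log t - ε * |Real.log t|) else 0

theorem integrable_majorant {ε : ℝ} (hε : 0 < ε) : Integrable (majorant ε) := by
  have h0 : IntegrableOn (majorant ε) (Set.Iic 0) := by
    refine (integrableOn_zero (s := Set.Iic (0 : ℝ))).congr_fun (fun t ht => ?_) measurableSet_Iic
    simp only [Set.mem_Iic] at ht
    simp [majorant, not_lt.2 ht]
  have h1 : IntegrableOn (majorant ε) (Set.Ioc 0 1) := by
    have h := (intervalIntegral.intervalIntegrable_rpow' (a := 0) (b := 1) (r := -1 + ε)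
      (by linarith)).1
    refine h.congr_fun (fun t ht => ?_) measurableSet_Ioc
    have hl : Real.log t ≤ 0 := Real.log_nonpos ht.1.le ht.2
    simp only [majorant, if_pos ht.1]
    rw [Real.rpow_def_of_pos ht.1, abs_of_nonpos hl]
    congr 1
    ring
  have h2 : IntegrableOn (majorant ε) (Set.Ioi 1) := by
    have h := integrableOn_Ioi_rpow_of_lt (a := -1 - ε) (c := 1) (by linarith) one_pos
    refine h.congr_fun (fun t ht => ?_) measurableSet_Ioi
    have ht0 : 0 < t := one_pos.trans ht
    have hl : 0 ≤ Real.log t := Real.log_nonneg (le_of_lt ht)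
    simp only [majorant, if_pos ht0]
    rw [Real.rpow_def_of_pos ht0, abs_of_nonneg hl]
    congr 1
    ring
  have h := (h0.union h1).union h2
  rw [Set.Iic_union_Ioc_eq_Iic zero_le_one, Set.Iic_union_Ioi] at h
  exact integrableOn_univ.1 h

/-- A region in the positive orthant on which Markov's inequality applies to a product of
integrable functions of one variable. -/
theorem volume_sum_log_add_abs_log_le_lt_top {d : ℕ} {ε : ℝ} (hε : 0 < ε) (K : ℝ) :
    volume {a : Fin d → ℝ | (∀ i, 0 < a i) ∧
      ∑ i, (Real.log (a i) + ε * |Real.log (a i)|) ≤ K} < ⊤ := by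
  have h : Integrable (fun a : Fin d → ℝ => ∏ i, majorant ε (a i)) :=
    Integrable.fintype_prod fun _ => integrable_majorant hε
  refine (measure_mono ?_).trans_lt (h.measure_ge_lt_top (Real.exp_pos (-K)))
  rintro a ⟨ha, hK⟩
  have : ∏ i, majorant ε (a i) =
      Real.exp (-∑ i, (Real.log (a i) + ε * |Real.log (a i)|)) := by
    rw [← Finset.sum_neg_distrib, Real.exp_sum]
    refine Finset.prod_congr rfl fun i _ => ?_
    rw [majorant, if_pos (ha i)]
    congr 1
    ring
  change Real.exp (-K) ≤ ∏ i, majorant ε (a i)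
  rw [this]
  exact Real.exp_le_exp.2 (by linarith)

/-- If the oscillation of `x` is at most `K - n ∑ xᵢ`, then `∑ xᵢ` is at most a constant minus a
multiple of `∑ |xᵢ|`. -/
theorem sum_add_abs_le {d n : ℕ} (hn : 0 < n) (hd : 0 < d) {K : ℝ} (hK : 0 ≤ K) (x : Fin d → ℝ)
    (h : ∀ p q, n * ∑ i, x i + (x p - x q) ≤ K) :
    ∑ i, (x i + (1 / (1 + d * n) : ℝ) * |x i|) ≤ K * (2 + d) := by
  set S := ∑ i, x i with hS
  -- this choice of `ε` makes the terms in `S` cancel when `S < 0`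
  set ε : ℝ := 1 / (1 + d * n) with hε
  have hd' : (0 : ℝ) < d := by exact_mod_cast hd
  have hn' : (1 : ℝ) ≤ n := by exact_mod_cast hn
  have hεpos : 0 < ε := by positivity
  have hε1 : ε * (1 + d * n) = 1 := by rw [hε]; field_simp
  have hεle : ε ≤ 1 := by nlinarith [mul_pos hd' (show (0 : ℝ) < n by linarith)]
  set M := K - n * S with hM
  have hM0 : 0 ≤ M := by linarith [h ⟨0, hd⟩ ⟨0, hd⟩]
  have habs : ∀ i, d * |x i| ≤ |S| + d * M := by
    intro i
    have h1 : d * x i - S = ∑ j, (x i - x j) := by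
      simp [Finset.sum_sub_distrib, hS]
    have h2 : |d * x i - S| ≤ d * M := by
      rw [h1]
      refine (Finset.abs_sum_le_sum_abs _ _).trans ?_
      have : ∀ j ∈ Finset.univ, |x i - x j| ≤ M := fun j _ =>
        abs_le.2 ⟨by linarith [h j i], by linarith [h i j]⟩
      simpa using Finset.sum_le_card_nsmul _ _ _ this
    have h3 : d * |x i| = |d * x i| := by rw [abs_mul, abs_of_pos hd']
    rw [h3]
    have := abs_sub_abs_le_abs_sub (d * x i) S
    linarith
  have hsum : ∑ i, |x i| ≤ |S| + d * M := by
    have h1 : ∑ i, d * |x i| ≤ d * (|S| + d * M) := by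
      have := Finset.sum_le_card_nsmul Finset.univ (fun i => d * |x i|) _ fun i _ => habs i
      rwa [Finset.card_univ, Fintype.card_fin, nsmul_eq_mul] at this
    rw [← Finset.mul_sum] at h1
    exact le_of_mul_le_mul_left h1 hd'
  rw [Finset.sum_add_distrib, ← Finset.mul_sum, ← hS]
  have h1 : S + ε * ∑ i, |x i| ≤ S + ε * (|S| + d * M) := by gcongr
  refine h1.trans ?_
  have hεd : ε * d ≤ d := by nlinarith
  have hεdK : ε * d * K ≤ d * K := by gcongr
  rcases le_or_gt 0 S with hS0 | hS0
  · have hSK : S ≤ K := by nlinarith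
    rw [abs_of_nonneg hS0]
    have h2 : ε * (d * M) ≤ ε * d * K := by
      rw [mul_assoc]
      gcongr
      nlinarith
    nlinarith
  · rw [abs_of_neg hS0]
    have h2 : S + ε * (-S + d * M) = ε * d * K + S * (1 - ε * (1 + d * n)) := by
      rw [hM]; ring
    rw [h2, hε1]
    linarith

/-- The finiteness statement in the coordinates given by the generators of the cone. -/
theorem volume_antitone_det_le_one_lt_top {n d : ℕ} (hn : 0 < n) (hd : 2 * d = n * (n + 1))
    (u : Fin d → Fin n → ℝ) (hu : LinearIndependent ℝ fun i => rankOneReal (u i)) :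
    volume {a : Fin d → ℝ | (∀ i, 0 < a i) ∧ Antitone a ∧
      (∑ i, a i • Matrix.vecMulVec (u i) (u i)).det ≤ 1} < ⊤ := by
  have hd0 : 0 < d := by nlinarith
  have hI := card_greedy hd u hu
  have hlin := (greedyBelow_spec u d).1
  rw [greedyBelow_self] at hlin
  obtain ⟨c, hc, hdet⟩ := exists_prod_le_det u (greedy u) hI hlin
  set K : ℝ := d * |Real.log c| with hK
  refine (measure_mono ?_).trans_lt (volume_sum_log_add_abs_log_le_lt_top
    (ε := 1 / (1 + d * n)) (by positivity) (K * (2 + d)))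
  rintro a ⟨ha, hanti, hle⟩
  refine ⟨ha, sum_add_abs_le hn hd0 (by positivity) (fun i => Real.log (a i)) fun p q => ?_⟩
  have h1 := sum_add_sub_le_of_antitone (greedy u) hI
    (fun m h0 hm => mul_lt_card_greedyBelow hd u hu h0 hm) (fun i => Real.log (a i))
    (fun i j hij => Real.log_le_log (ha j) (hanti hij)) p q
  refine h1.trans ?_
  have h2 : Real.log (c * ∏ i ∈ greedy u, a i) ≤ 0 :=
    Real.log_nonpos (mul_nonneg hc.le (Finset.prod_nonneg fun i _ => (ha i).le))
      ((hdet a ha).trans hle)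
  rw [Real.log_mul hc.ne' (Finset.prod_pos fun i _ => ha i).ne',
    Real.log_prod fun i _ => (ha i).ne'] at h2
  rw [hK]
  gcongr
  linarith [neg_abs_le (Real.log c)]

theorem rankOne_eq_rankOneReal {n : ℕ} (v : NZVec n) :
    rankOne v = rankOneReal fun i => (v.1 i : ℝ) := by
  ext i j
  simp [rankOne, rankOneReal, Matrix.vecMulVec_apply]

theorem volume_exists_eq_zero (d : ℕ) : volume {a : Fin d → ℝ | ∃ i, a i = 0} = 0 := by
  rw [Set.ofPred_exists]
  refine measure_iUnion_null fun i => ?_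
  refine Measure.addHaar_submodule volume
    (LinearMap.ker (LinearMap.proj i : (Fin d → ℝ) →ₗ[ℝ] ℝ)) fun h => ?_
  have : (1 : Fin d → ℝ) ∈ LinearMap.ker (LinearMap.proj i : (Fin d → ℝ) →ₗ[ℝ] ℝ) :=
    h ▸ Submodule.mem_top
  simp at this

/-- The part of a simplicial cone where the coefficients are in decreasing order has finite
truncated volume. -/
theorem truncVolume_antitone_lt_top {n : ℕ} (hn : 0 < n) (v : Fin (n + vcd n) → NZVec n)
    (hv : LinearIndependent ℝ fun i => rankOne (v i)) :
    truncVolume n {y | ∃ a : Fin (n + vcd n) → ℝ, (∀ i, 0 ≤ a i) ∧ Antitone a ∧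
      y = ∑ i, a i • rankOne (v i)} < ⊤ := by
  let b : Module.Basis (Fin (n + vcd n)) ℝ (SymMat n) := basisOfLinearIndependentOfCardEqFinrank'
    _ hv (by rw [finrank_symMat, Fintype.card_fin])
  let L : SymMat n ≃L[ℝ] (Fin (n + vcd n) → ℝ) := b.equivFun.toContinuousLinearEquiv
  have hL : ∀ a : Fin (n + vcd n) → ℝ, L (∑ i, a i • rankOne (v i)) = a := by
    intro a
    have : ∑ i, a i • rankOne (v i) = b.equivFun.symm a := by
      simp [b, Module.Basis.equivFun_symm_apply]
    rw [this]
    exact b.equivFun.apply_symm_apply a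
  have hc := Measure.isAddLeftInvariant_eq_smul (Measure.map L (lebesgueSym n)) volume
  rw [truncVolume, Measure.restrict_apply' (measurableSet_trunc n)]
  set E : Set (Fin (n + vcd n) → ℝ) := {a | (∀ i, 0 < a i) ∧ Antitone a ∧
    (∑ i, a i • Matrix.vecMulVec (fun j => ((v i).1 j : ℝ)) (fun j => ((v i).1 j : ℝ))).det ≤ 1} ∪
    {a | ∃ i, a i = 0} with hE
  have hfin : volume E < ⊤ := by
    refine (measure_union_le _ _).trans_lt (ENNReal.add_lt_top.2 ⟨?_, ?_⟩)
    · refine volume_antitone_det_le_one_lt_top hn (two_mul_add_vcd n) _ ?_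
      simpa only [rankOne_eq_rankOneReal] using hv
    · rw [volume_exists_eq_zero]
      exact ENNReal.zero_lt_top
  refine lt_of_le_of_lt (b := Measure.map L (lebesgueSym n) E) ?_ ?_
  · refine le_trans (measure_mono ?_) (Measure.le_map_apply L.continuous.measurable.aemeasurable E)
    rintro _ ⟨⟨a, ha, hanti, rfl⟩, -, hdet⟩
    rw [Set.mem_preimage, hL]
    by_cases h0 : ∃ i, a i = 0
    · exact Or.inr h0
    push Not at h0
    refine Or.inl ⟨fun i => lt_of_le_of_ne (ha i) (h0 i).symm, hanti, ?_⟩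
    convert hdet using 2
    rw [AddSubmonoidClass.coe_finsetSum]
    refine Finset.sum_congr rfl fun i _ => ?_
    rw [rankOne_eq_rankOneReal]
    rfl
  · rw [hc]
    exact ENNReal.mul_lt_top ENNReal.coe_lt_top hfin

theorem truncVolume_cone_lt_top {n : ℕ} (hn : 0 < n) (v : Fin (n + vcd n) → NZVec n) :
    truncVolume n (cone v) < ⊤ := by
  by_cases hv : LinearIndependent ℝ fun i => rankOne (v i)
  · have hsub : cone v ⊆ ⋃ σ : Equiv.Perm (Fin (n + vcd n)),
        {y | ∃ a : Fin (n + vcd n) → ℝ, (∀ i, 0 ≤ a i) ∧ Antitone a ∧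
          y = ∑ i, a i • rankOne (v (σ i))} := by
      rintro y ⟨a, ha, rfl⟩
      -- sorting the coefficients puts `y` into one of finitely many smaller cones
      set σ := Tuple.sort fun i => -a i
      refine Set.mem_iUnion.2 ⟨σ, a ∘ σ, fun i => ha _, fun i j hij => ?_, ?_⟩
      · have := Tuple.monotone_sort (fun i => -a i) hij
        simpa using this
      · exact (Equiv.sum_comp σ fun i => a i • rankOne (v i)).symm
    refine (measure_mono hsub).trans_lt ((measure_iUnion_le _).trans_lt ?_)
    rw [tsum_fintype]
    exact ENNReal.sum_lt_top.2 fun σ _ =>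
      truncVolume_antitone_lt_top hn (fun i => v (σ i)) (hv.comp σ σ.injective)
  · rw [truncVolume_cone_of_not_linearIndependent v hv]
    exact ENNReal.zero_lt_top

/-! ### Signed volumes as determinants times volumes -/

theorem exists_basis_orientation {n : ℕ} (hn : 0 < n)
    (o : Orientation ℝ (SymMat n) (Fin (n + vcd n))) :
    ∃ b : Module.Basis (Fin (n + vcd n)) ℝ (SymMat n), b.orientation = o := by
  have : Nonempty (Fin (n + vcd n)) := ⟨⟨0, by omega⟩⟩
  exact ⟨o.someBasis (by rw [finrank_symMat, Fintype.card_fin]), o.someBasis_orientation _⟩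

theorem positivelyOrdered_iff {n : ℕ} (b : Module.Basis (Fin (n + vcd n)) ℝ (SymMat n))
    (v : Fin (n + vcd n) → NZVec n) :
    PositivelyOrdered b.orientation v ↔ 0 < b.det fun i => rankOne (v i) := by
  constructor
  · rintro ⟨b', hb', ho⟩
    have h := (Module.Basis.orientation_eq_iff_det_pos b b').1 ho.symm
    rwa [show (b' : Fin (n + vcd n) → SymMat n) = fun i => rankOne (v i) from funext hb'] at h
  · intro h
    obtain ⟨h1, h2⟩ := (Module.Basis.is_basis_iff_det b).2 (isUnit_iff_ne_zero.2 h.ne')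
    refine ⟨Module.Basis.mk h1 h2.ge, fun i => by simp, ?_⟩
    rw [eq_comm, Module.Basis.orientation_eq_iff_det_pos]
    simpa using h

theorem span_rankOne_eq_top {n : ℕ} {v : Fin (n + vcd n) → NZVec n}
    (hv : LinearIndependent ℝ fun i => rankOne (v i)) :
    Submodule.span ℝ (Set.range fun i => rankOne (v i)) = ⊤ :=
  hv.span_eq_top_of_card_eq_finrank' (by rw [finrank_symMat, Fintype.card_fin])

theorem coneVol_eq_zero_of_not_linearIndependent {n : ℕ} {v : Fin (n + vcd n) → NZVec n}
    (hv : ¬ LinearIndependent ℝ fun i => rankOne (v i)) : coneVol (cone v) = 0 := by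
  rw [coneVol_cone, Measure.real, truncVolume_cone_of_not_linearIndependent v hv,
    ENNReal.toReal_zero]

/-- When the determinant vanishes, the sign in `signedVol` is `-1`, but the volume is zero. -/
theorem signedVol_eq_sign_det_mul {n : ℕ} (b : Module.Basis (Fin (n + vcd n)) ℝ (SymMat n))
    (v : Fin (n + vcd n) → NZVec n) :
    signedVol b.orientation v =
      ((SignType.sign (b.det fun i => rankOne (v i)) : SignType) : ℝ) * coneVol (cone v) := by
  rw [signedVol]
  rcases lt_trichotomy (b.det fun i => rankOne (v i)) 0 with h | h | h
  · rw [if_neg (by rw [positivelyOrdered_iff]; exact h.not_gt), sign_neg h]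
    simp
  · have hv : ¬ LinearIndependent ℝ fun i => rankOne (v i) := fun hv =>
      isUnit_iff_ne_zero.1 ((Module.Basis.is_basis_iff_det b).1 ⟨hv, span_rankOne_eq_top hv⟩) h
    rw [coneVol_eq_zero_of_not_linearIndependent hv]
    simp
  · rw [if_pos ((positivelyOrdered_iff b v).2 h), sign_pos h]
    simp

/-! ### Signed volumes respect the relators -/

theorem cone_subset_cone {n m : ℕ} {v w : Fin m → NZVec n}
    (h : ∀ i, ∃ c : ℝ, 0 ≤ c ∧ rankOne (w i) = c • rankOne (v i)) : cone w ⊆ cone v := by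
  choose c hc h using h
  rintro y ⟨a, ha, rfl⟩
  exact ⟨fun i => a i * c i, fun i => mul_nonneg (ha i) (hc i), by simp [h, mul_smul]⟩

theorem cone_comp_perm {n m : ℕ} (v : Fin m → NZVec n) (σ : Equiv.Perm (Fin m)) :
    cone (v ∘ σ) = cone v := by
  ext y
  constructor
  · rintro ⟨a, ha, rfl⟩
    refine ⟨a ∘ σ.symm, fun i => ha _, ?_⟩
    rw [← Equiv.sum_comp σ fun i => (a ∘ σ.symm) i • rankOne (v i)]
    simp
  · rintro ⟨a, ha, rfl⟩
    exact ⟨a ∘ σ, fun i => ha _, (Equiv.sum_comp σ fun i => a i • rankOne (v i)).symm⟩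

theorem rankOne_scale {n : ℕ} (a : ℚˣ) (v : NZVec n) :
    rankOne (v.scale a) = ((a : ℚ) : ℝ) ^ 2 • rankOne v := by
  ext i j
  simp [rankOne, NZVec.scale]
  ring

theorem cone_update_scale {n m : ℕ} (v : Fin m → NZVec n) (i : Fin m) (a : ℚˣ) :
    cone (Function.update v i ((v i).scale a)) = cone v := by
  have ha : ((a : ℚ) : ℝ) ≠ 0 := by exact_mod_cast a.ne_zero
  refine Set.Subset.antisymm (cone_subset_cone fun j => ?_) (cone_subset_cone fun j => ?_)
  · by_cases hj : j = i
    · subst hj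
      exact ⟨_, sq_nonneg _, by rw [Function.update_self, rankOne_scale]⟩
    · exact ⟨1, zero_le_one, by simp [hj]⟩
  · by_cases hj : j = i
    · subst hj
      exact ⟨(((a : ℚ) : ℝ) ^ 2)⁻¹, by positivity, by
        rw [Function.update_self, rankOne_scale, smul_smul, inv_mul_cancel₀ (pow_ne_zero 2 ha),
          one_smul]⟩
    · exact ⟨1, zero_le_one, by simp [hj]⟩

/-- The value `ᵗx y x` of the quadratic form `y` at `x`, as a linear functional of `y`. -/
def evalForm {n : ℕ} (x : Fin n → ℝ) : SymMat n →ₗ[ℝ] ℝ where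
  toFun y := x ⬝ᵥ y.1.mulVec x
  map_add' y z := by simp [Matrix.add_mulVec]
  map_smul' a y := by simp [Matrix.smul_mulVec]

theorem evalForm_rankOne {n : ℕ} (x : Fin n → ℝ) (v : NZVec n) :
    evalForm x (rankOne v) = (x ⬝ᵥ fun i => (v.1 i : ℝ)) ^ 2 := by
  rw [rankOne_eq_rankOneReal]
  simp only [evalForm, rankOneReal, LinearMap.coe_mk, AddHom.coe_mk]
  rw [Matrix.vecMulVec_mulVec]
  simp [sq, dotProduct_comm]

theorem eq_zero_of_evalForm_rankOne_eq_zero {n m : ℕ} {v : Fin m → NZVec n}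
    (hv : Submodule.span ℝ (Set.range fun i => rankOne (v i)) = ⊤) (x : Fin n → ℝ)
    (h : ∀ i, evalForm x (rankOne (v i)) = 0) : x = 0 := by
  have h0 : evalForm x = 0 := LinearMap.ext_on_range hv fun i => by simpa using h i
  have h1 : evalForm x ⟨1, Matrix.isSymm_one⟩ = 0 := by rw [h0]; rfl
  simpa [evalForm] using h1

/-- A linear form vanishing on all `vᵢ` has a square that pairs to zero with all `vᵢ'`. -/
theorem not_linearIndependent_of_span_ne_top {n : ℕ} (v : Fin (n + vcd n) → NZVec n)
    (hv : Submodule.span ℚ (Set.range fun i => (v i).1) ≠ ⊤) :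
    ¬ LinearIndependent ℝ fun i => rankOne (v i) := by
  intro hli
  obtain ⟨f, hf, hle⟩ := Submodule.exists_le_ker_of_lt_top _ (lt_top_iff_ne_top.2 hv)
  set x : Fin n → ℝ := fun i => ((f (Pi.single i 1) : ℚ) : ℝ) with hx
  have hdot : ∀ i, x ⬝ᵥ (fun j => ((v i).1 j : ℝ)) = 0 := by
    intro i
    have h0 : f (v i).1 = 0 := hle (Submodule.subset_span ⟨i, rfl⟩)
    have hs : ∀ j : Fin n, (fun k => if j = k then (1 : ℚ) else 0) = Pi.single j 1 := fun j => by
      ext k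
      simp [Pi.single_apply, eq_comm]
    rw [LinearMap.pi_apply_eq_sum_univ f] at h0
    simp only [hs] at h0
    have h1 := congrArg (fun q : ℚ => (q : ℝ)) h0
    simp only [smul_eq_mul, Rat.cast_sum, Rat.cast_mul, Rat.cast_zero] at h1
    rw [← h1, dotProduct]
    exact Finset.sum_congr rfl fun j _ => mul_comm _ _
  have hx0 := eq_zero_of_evalForm_rankOne_eq_zero (span_rankOne_eq_top hli) x fun i => by
    rw [evalForm_rankOne, hdot, zero_pow two_ne_zero]
  refine hf (LinearMap.pi_ext' fun i => LinearMap.ext_ring ?_)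
  have := congrFun hx0 i
  simpa [hx] using this

/-- The linear functional on sharblies whose values on basic sharblies are the signed volumes. -/
noncomputable def volumeCosharbly {n : ℕ} (b : Module.Basis (Fin (n + vcd n)) ℝ (SymMat n)) :
    Sh n (vcd n) →ₗ[ℚ] ℝ :=
  liftSh (signedVol b.orientation)
    (fun v σ => by
      rw [signedVol_eq_sign_det_mul, signedVol_eq_sign_det_mul, cone_comp_perm]
      have h := b.det.map_perm (fun i => rankOne (v i)) σ
      change b.det (fun i => rankOne ((v ∘ σ) i)) = _ at h
      rw [h]
      rcases Int.units_eq_one_or (Equiv.Perm.sign σ) with hσ | hσ <;>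
        simp [hσ, Left.sign_neg])
    (fun v hv => by
      rw [signedVol, coneVol_eq_zero_of_not_linearIndependent
        (not_linearIndependent_of_span_ne_top v hv), mul_zero])
    (fun v i a => by
      rw [signedVol_eq_sign_det_mul, signedVol_eq_sign_det_mul, cone_update_scale]
      have h : (fun j => rankOne (Function.update v i ((v i).scale a) j)) =
          Function.update (fun j => rankOne (v j)) i (((a : ℚ) : ℝ) ^ 2 • rankOne (v i)) := by
        ext1 j
        by_cases hj : j = i
        · subst hj
          simp [rankOne_scale]
        · simp [hj]
      have ha : ((a : ℚ) : ℝ) ≠ 0 := by exact_mod_cast a.ne_zero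
      rw [h, AlternatingMap.map_update_smul, Function.update_eq_self, smul_eq_mul, sign_mul,
        sign_pos (by positivity), one_mul])

theorem volumeCosharbly_basic {n : ℕ} (b : Module.Basis (Fin (n + vcd n)) ℝ (SymMat n))
    (v : Fin (n + vcd n) → NZVec n) :
    volumeCosharbly b (basic v) = signedVol b.orientation v :=
  liftSh_basic _ _ _ _ v

/-! ### Invariance under the special linear group over the integers -/

theorem rankOne_act {n : ℕ} (g : SL(n, ℤ)) (v : NZVec n) :
    rankOne (v.act (Matrix.SpecialLinearGroup.toGL
      (Matrix.SpecialLinearGroup.map (Int.castRingHom ℚ) g))) =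
      actSym (Matrix.SpecialLinearGroup.map (Int.castRingHom ℝ) g) (rankOne v) := by
  rw [actSym_eq_congrSym, rankOne_eq_rankOneReal, rankOne_eq_rankOneReal, congrSym_rankOneReal]
  congr 1
  ext i
  simp [NZVec.act, Matrix.mulVec, dotProduct]

theorem signedVol_act {n : ℕ} (b : Module.Basis (Fin (n + vcd n)) ℝ (SymMat n)) (g : SL(n, ℤ))
    (v : Fin (n + vcd n) → NZVec n) :
    signedVol b.orientation (fun i => (v i).act (Matrix.SpecialLinearGroup.toGL
      (Matrix.SpecialLinearGroup.map (Int.castRingHom ℚ) g))) = signedVol b.orientation v := by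
  set w : Fin (n + vcd n) → NZVec n := fun i => (v i).act (Matrix.SpecialLinearGroup.toGL
      (Matrix.SpecialLinearGroup.map (Int.castRingHom ℚ) g)) with hw
  set h : SL(n, ℝ) := Matrix.SpecialLinearGroup.map (Int.castRingHom ℝ) g with hh
  have hwv : ∀ i, rankOne (w i) = congrSym h.1 (rankOne (v i)) := fun i => rankOne_act g (v i)
  have hcone : cone w = actSym h '' cone v := by
    rw [actSym_eq_congrSym]
    ext y
    constructor
    · rintro ⟨a, ha, rfl⟩
      exact ⟨_, ⟨a, ha, rfl⟩, by simp [hwv]⟩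
    · rintro ⟨_, ⟨a, ha, rfl⟩, rfl⟩
      exact ⟨a, ha, by simp [hwv]⟩
  have hdet : (b.det fun i => rankOne (w i)) = b.det fun i => rankOne (v i) := by
    have := b.det_comp (congrSym h.1) fun i => rankOne (v i)
    rw [det_congrSym_SL, one_mul] at this
    rw [← this]
    congr 1
    exact funext hwv
  rw [signedVol_eq_sign_det_mul, signedVol_eq_sign_det_mul, hdet, coneVol_cone, coneVol_cone,
    Measure.real, Measure.real, hcone, truncVolume_image_actSym]
  rw [← hcone]
  exact measurableSet_cone w

/-- Signed volumes are invariant since `y ↦ g y ᵗg` has determinant one on `Y`: it preserves both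
the orientation and the volume. -/
theorem isCosharbly_volumeCosharbly {n : ℕ}
    (b : Module.Basis (Fin (n + vcd n)) ℝ (SymMat n)) (G : Subgroup SL(n, ℤ)) :
    IsCosharbly G (volumeCosharbly b) := by
  intro g _ z
  have h : volumeCosharbly b ∘ₗ actSh (Matrix.SpecialLinearGroup.toGL
      (Matrix.SpecialLinearGroup.map (Int.castRingHom ℚ) g)) = volumeCosharbly b := by
    refine Submodule.linearMap_qext _ (Finsupp.lhom_ext' fun v => LinearMap.ext_ring ?_)
    change volumeCosharbly b (actSh _ (basic v)) = volumeCosharbly b (basic v)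
    rw [actSh, liftSh_basic, volumeCosharbly_basic, volumeCosharbly_basic, signedVol_act]
  exact LinearMap.congr_fun h z

/-! ### The cocycle condition -/

theorem trace_rankOne_pos {n : ℕ} (v : NZVec n) : 0 < (rankOne v).1.trace := by
  have h : ∃ i, v.1 i ≠ 0 := Function.ne_iff.1 v.2
  obtain ⟨i, hi⟩ := h
  have : (rankOne v).1.trace = ∑ j, (v.1 j : ℝ) * (v.1 j : ℝ) := rfl
  rw [this]
  refine Finset.sum_pos' (fun j _ => mul_self_nonneg _) ⟨i, Finset.mem_univ _, ?_⟩
  exact mul_self_pos.2 (by exact_mod_cast hi)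

/-- The signed indicator functions of the cones cancel outside a null set; integrate them. -/
theorem sum_signedVol_succAbove {n : ℕ} (hn : 0 < n)
    (b : Module.Basis (Fin (n + vcd n)) ℝ (SymMat n)) (v : Fin (n + vcd n + 1) → NZVec n) :
    ∑ i : Fin (n + vcd n + 1),
      (-1 : ℝ) ^ (i : ℕ) * signedVol b.orientation (fun j => v (i.succAbove j)) = 0 := by
  classical
  set u : Fin (n + vcd n + 1) → SymMat n := fun i => rankOne (v i) with hu
  set K : Fin (n + vcd n + 1) → Set (SymMat n) := fun i => cone fun j => v (i.succAbove j) with hK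
  have hterm : ∀ i : Fin (n + vcd n + 1),
      (-1 : ℝ) ^ (i : ℕ) * signedVol b.orientation (fun j => v (i.succAbove j)) =
        ∫ y, ((SignType.sign (cramerCoeff b u i) : SignType) : ℝ) *
          (K i).indicator 1 y ∂(truncVolume n) := by
    intro i
    rw [integral_const_mul, integral_indicator_one (measurableSet_cone _),
      signedVol_eq_sign_det_mul, coneVol_cone, ← mul_assoc]
    congr 1
    rw [cramerCoeff, sign_mul, sign_pow, Left.sign_neg, sign_one]
    simp [hu, Function.comp_def]
  have hint : ∀ i ∈ Finset.univ, Integrable (fun y =>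
      ((SignType.sign (cramerCoeff b u i) : SignType) : ℝ) * (K i).indicator (1 : SymMat n → ℝ) y)
      (truncVolume n) := fun i _ =>
    ((integrable_indicator_iff (measurableSet_cone _)).2
      (integrableOn_const (truncVolume_cone_lt_top hn _).ne)).const_mul _
  rw [Finset.sum_congr rfl fun i _ => hterm i, ← integral_finsetSum _ hint]
  have hgen : ∀ᵐ y ∂(truncVolume n), ∀ i j, i ≠ j →
      y ∉ Submodule.span ℝ (u '' {k | k ≠ i ∧ k ≠ j}) := by
    refine ae_all_iff.2 fun i => ae_all_iff.2 fun j => ?_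
    by_cases hij : i = j
    · simp [hij]
    · have h0 : truncVolume n (Submodule.span ℝ (u '' {k | k ≠ i ∧ k ≠ j}) : Set (SymMat n)) = 0 :=
        le_antisymm ((Measure.restrict_apply_le _ _).trans
          (lebesgueSym_submodule _ (span_omit_two_ne_top b u hij)).le) zero_le
      filter_upwards [measure_eq_zero_iff_ae_notMem.1 h0] with y hy _
      exact hy
  rw [integral_congr_ae (g := fun _ => (0 : ℝ)), integral_zero]
  filter_upwards [hgen] with y hy
  have h := sum_sign_indicator_conicHull b u (Matrix.traceLinearMap (Fin n) ℝ ℝ ∘ₗ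
    (SymMat n).subtype) (fun i => trace_rankOne_pos (v i)) y hy
  rw [← h]
  refine Finset.sum_congr rfl fun i _ => ?_
  rw [Set.indicator_apply]
  rfl

theorem isCosharblyCocycle_volumeCosharbly {n : ℕ} (hn : 0 < n)
    (b : Module.Basis (Fin (n + vcd n)) ℝ (SymMat n)) (G : Subgroup SL(n, ℤ)) :
    IsCosharblyCocycle G (volumeCosharbly b) := by
  refine ⟨isCosharbly_volumeCosharbly b G, fun v => ?_⟩
  have h : boundary (basic v) = boundaryBasic v := liftSh_basic _ _ _ _ v
  rw [h, boundaryBasic, map_sum, ← sum_signedVol_succAbove hn b v]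
  refine Finset.sum_congr rfl fun i _ => ?_
  rw [map_smul, volumeCosharbly_basic, Rat.smul_def]
  push_cast
  rfl

/-! ### Positivity -/

/-- In the interior of the cone, the matrices are positive definite, and those of small determinant
form a nonempty open set. -/
theorem coneVol_pos {n : ℕ} (hn : 0 < n) {o : Orientation ℝ (SymMat n) (Fin (n + vcd n))}
    {v : Fin (n + vcd n) → NZVec n} (hv : PositivelyOrdered o v) : 0 < coneVol (cone v) := by
  obtain ⟨b, hb, -⟩ := hv
  have hb' : (fun i => rankOne (v i)) = b := funext fun i => (hb i).symm
  set U : Set (SymMat n) := {y | (∀ i, 0 < b.equivFun y i) ∧ y.1.det < 1} with hU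
  have hopen : IsOpen U := by
    have h1 : IsOpen {y : SymMat n | ∀ i, 0 < b.equivFun y i} := by
      rw [Set.ofPred_forall]
      refine isOpen_iInter_of_finite fun i => isOpen_lt continuous_const ?_
      exact (continuous_apply i).comp b.equivFun.toContinuousLinearEquiv.continuous
    have h2 : IsOpen {y : SymMat n | y.1.det < 1} := isOpen_lt (by fun_prop) continuous_const
    exact h1.inter h2
  have hne : U.Nonempty := by
    set D := (b.equivFun.symm 1).1.det
    -- a small enough multiple of the sum of the generators
    set t : ℝ := 1 / (1 + |D|) with ht
    have hpos : 0 < 1 + |D| := by positivity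
    have ht0 : 0 < t := by positivity
    have ht1 : t ≤ 1 := by
      rw [ht, div_le_one hpos]
      linarith [abs_nonneg D]
    refine ⟨t • b.equivFun.symm 1, fun i => ?_, ?_⟩
    · simpa using ht0
    · change (t • (b.equivFun.symm 1).1).det < 1
      rw [Matrix.det_smul, Fintype.card_fin]
      calc t ^ n * D ≤ t ^ n * |D| := by gcongr; exact le_abs_self D
        _ ≤ t * |D| := by
          gcongr
          exact pow_le_of_le_one ht0.le ht1 hn.ne'
        _ < 1 := by
          rw [ht, one_div, inv_mul_lt_iff₀ hpos]
          linarith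
  have hsub : U ⊆ cone v ∩ {y | y.1.PosDef ∧ y.1.det ≤ 1} := by
    rintro y ⟨hy, hdet⟩
    have hsum : y = ∑ i, b.equivFun y i • rankOne (v i) := by
      conv_lhs => rw [← b.sum_equivFun y]
      exact Finset.sum_congr rfl fun i _ => by rw [hb]
    refine ⟨⟨_, fun i => (hy i).le, hsum⟩, ?_, hdet.le⟩
    refine Matrix.posDef_iff_dotProduct_mulVec.2 ⟨?_, fun x hx => ?_⟩
    · rw [Matrix.IsHermitian, Matrix.conjTranspose_eq_transpose_of_trivial]
      exact y.2
    · have hval : star x ⬝ᵥ y.1.mulVec x =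
          ∑ i, b.equivFun y i * evalForm x (rankOne (v i)) := by
        have := congrArg (evalForm x) hsum
        rw [map_sum] at this
        simp only [map_smul, smul_eq_mul] at this
        rw [star_trivial]
        exact this
      have hnn : ∀ i, 0 ≤ evalForm x (rankOne (v i)) := fun i => by
        rw [evalForm_rankOne]
        exact sq_nonneg _
      rw [hval]
      refine lt_of_le_of_ne (Finset.sum_nonneg fun i _ => mul_nonneg (hy i).le (hnn i))
        fun h0 => hx ?_
      refine eq_zero_of_evalForm_rankOne_eq_zero (v := v) (by rw [hb', b.span_eq]) x fun i => ?_
      have := (Finset.sum_eq_zero_iff_of_nonneg fun i _ => mul_nonneg (hy i).le (hnn i)).1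
        h0.symm i (Finset.mem_univ i)
      exact (mul_eq_zero.1 this).resolve_left (hy i).ne'
  rw [coneVol_cone]
  refine ENNReal.toReal_pos ?_ (truncVolume_cone_lt_top hn v).ne
  rw [truncVolume, Measure.restrict_apply (measurableSet_cone v)]
  exact ((hopen.measure_pos (lebesgueSym n) hne).trans_le (measure_mono hsub)).ne'

theorem not_linearIndependent_of_isFlipon {n : ℕ} (hn : 2 ≤ n) {w : Fin (n + vcd n) → NZVec n}
    (hw : IsFlipon w) : ¬ LinearIndependent ℝ fun i => rankOne (w i) := by
  intro hli
  obtain ⟨S, hS, hmem⟩ := hw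
  let i₀ : Fin (n + vcd n) := ⟨0, by omega⟩
  have hle : Submodule.span ℝ (Set.range fun i => rankOne (w i)) ≤
      S.direction ⊔ Submodule.span ℝ {rankOne (w i₀)} := by
    rw [Submodule.span_le]
    rintro _ ⟨i, rfl⟩
    have h1 : rankOne (w i) - rankOne (w i₀) ∈ S.direction :=
      AffineSubspace.vsub_mem_direction (hmem i) (hmem i₀)
    have h2 := Submodule.add_mem_sup h1 (Submodule.mem_span_singleton_self (R := ℝ) (rankOne (w i₀)))
    simpa using h2
  have h1 := Submodule.finrank_mono hle
  have h2 := Submodule.finrank_add_le_finrank_add_finrank S.direction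
    (Submodule.span ℝ {rankOne (w i₀)})
  have h3 := finrank_span_le_card (R := ℝ) ({rankOne (w i₀)} : Set (SymMat n))
  rw [Set.toFinset_singleton, Finset.card_singleton] at h3
  rw [span_rankOne_eq_top hli, finrank_top, finrank_symMat] at h1
  omega

end Sharbly

theorem mainTheorem3 (n : ℕ) (hn : 2 ≤ n)
    (o : Orientation ℝ (SymMat n) (Fin (n + vcd n))) :
    -- `invVolume n` is an `SLₙ(ℝ)`-invariant volume on `C/A`
    (∀ g : SL(n, ℝ), Measure.map (actSymSpace g) (invVolume n) = invVolume n) ∧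
    -- the improper integrals defining the volumes converge
    (∀ v : Fin (n + vcd n) → NZVec n, invVolume n (imageModA (cone v)) < ⊤) ∧
    ∃ μ : Sh n (vcd n) →ₗ[ℚ] ℝ,
      (∀ v : Fin (n + vcd n) → NZVec n, μ (basic v) = signedVol o v) ∧
      (∀ G : Subgroup SL(n, ℤ), IsCosharblyCocycle G μ) ∧
      ∀ (p q : ℕ) (lam : Fin p → ℚ) (kap : Fin q → ℚ)
        (s : Fin p → Fin (n + vcd n) → NZVec n) (w : Fin q → Fin (n + vcd n) → NZVec n),
        0 < p → (∀ i, 0 < lam i) → (∀ i, PositivelyOrdered o (s i)) →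
        (∀ j, IsFlipon (w j)) →
        μ (∑ i, lam i • basic (s i) + ∑ j, kap j • basic (w j)) ≠ 0 := by
  have hn0 : 0 < n := by omega
  -- `b` is a basis of `Y` inducing the given orientation
  obtain ⟨b, rfl⟩ := exists_basis_orientation hn0 o
  refine ⟨map_actSymSpace_invVolume, fun v => ?_, volumeCosharbly b, volumeCosharbly_basic b,
    isCosharblyCocycle_volumeCosharbly hn0 b, ?_⟩
  · rw [invVolume_cone]
    exact truncVolume_cone_lt_top hn0 v
  · intro p q lam kap s w hp hlam hs hw
    have hzero : ∀ j, volumeCosharbly b (basic (w j)) = 0 := fun j => by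
      rw [volumeCosharbly_basic, signedVol, coneVol_eq_zero_of_not_linearIndependent
        (not_linearIndependent_of_isFlipon hn (hw j)), mul_zero]
    have hpos : ∀ i, 0 < volumeCosharbly b (basic (s i)) := fun i => by
      rw [volumeCosharbly_basic, signedVol, if_pos (hs i), one_mul]
      exact coneVol_pos hn0 (hs i)
    have : Nonempty (Fin p) := ⟨⟨0, hp⟩⟩
    simp only [map_add, map_sum, map_smul, hzero, smul_zero, Finset.sum_const_zero, add_zero]
    refine (Finset.sum_pos (fun i _ => ?_) Finset.univ_nonempty).ne'
    rw [Rat.smul_def]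
    exact mul_pos (by exact_mod_cast hlam i) (hpos i)
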